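/- There is an absolute constant $C$ such that the following holds for all integers $\Delta\ge 0$ and $n\ge 2$. Let $\mathcal P\subseteq\mathbb R^d$ be a polytope (the convex hull of finitely many points) whose affine hull has dimension $n$. A slack matrix of $\mathcal P$ is a matrix $\mathbf S$ with rows indexed by the facets of $\mathcal P$ and columns indexed by its vertices, obtained by choosing for every facet $f$ a halfspace $\{x : a_f^\top x\le b_f\}$ that contains $\mathcal P$ and satisfies $f=\{x\in\mathcal P : a_f^\top x=b_f\}$, and setting $\mathbf S_{f,v}=b_f-a_f^\top v$. The extension complexity $\mathrm{xc}(\mathcal P)$ is the minimum number of facets of a polytope $\mathcal Q\subseteq\mathbb R^m$, with $m$ arbitrary, such that $\pi(\mathcal Q)=\mathcal P$ for some linear map $\pi:\mathbb R^m\to\mathbb R^d$. If $\mathcal P$ has a slack matrix all of whose entries are integers in $\{0,1,\dots,\Delta\}$, then $$\mathrm{xc}(\mathcal P)\le \exp\!\big(\max\{\Delta,2\}^{C\Delta}\cdot\sqrt n\cdot\log n\big).$$ -/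

import Mathlib

/-- A polytope in `ℝ^d`: the convex hull of finitely many points. -/
def IsPolytope {d : ℕ} (P : Set (Fin d → ℝ)) : Prop :=
  ∃ s : Set (Fin d → ℝ), s.Finite ∧ P = convexHull ℝ s

/-- The dimension of (the affine hull of) a nonempty subset of `ℝ^d`. -/
noncomputable def affDim {d : ℕ} (P : Set (Fin d → ℝ)) : ℕ :=
  Module.finrank ℝ (vectorSpan ℝ P)

/-- `F` is a facet of `P`: a nonempty face of dimension one less than that of `P`
(the faces of a polytope are its exposed faces). -/
def IsFacet {d : ℕ} (P F : Set (Fin d → ℝ)) : Prop :=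
  F.Nonempty ∧ IsExposed ℝ P F ∧ affDim F + 1 = affDim P

/-- The extension complexity of `P`: the least number of facets of a polytope `Q`, in a space of
any dimension, that a linear map carries onto `P`. -/
noncomputable def extensionComplexity {d : ℕ} (P : Set (Fin d → ℝ)) : ℕ∞ :=
  sInf {k : ℕ∞ | ∃ (m : ℕ) (Q : Set (Fin m → ℝ)) (π : (Fin m → ℝ) →ₗ[ℝ] (Fin d → ℝ)),
    IsPolytope Q ∧ π '' Q = P ∧ k = {F | IsFacet Q F}.encard}

/-- The halfspace `a ⬝ x ≤ b` contains `P` and defines its face `F`. -/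
def DefinesFace {d : ℕ} (P F : Set (Fin d → ℝ)) (a : Fin d → ℝ) (b : ℝ) : Prop :=
  (∀ x ∈ P, a ⬝ᵥ x ≤ b) ∧ F = {x ∈ P | a ⬝ᵥ x = b}

/-- `S`, with rows indexed by the facets and columns by the vertices of `P`, is a slack matrix
of `P`: its entries are the slacks `b_f - a_f ⬝ v` for some choice of one defining halfspace
`a_f ⬝ x ≤ b_f` for each facet `f`. -/
def IsSlackMatrix {d : ℕ} (P : Set (Fin d → ℝ))
    (S : Matrix {F : Set (Fin d → ℝ) // IsFacet P F} (P.extremePoints ℝ) ℝ) : Prop :=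
  ∃ (a : {F : Set (Fin d → ℝ) // IsFacet P F} → (Fin d → ℝ))
    (b : {F : Set (Fin d → ℝ) // IsFacet P F} → ℝ),
    (∀ f, DefinesFace P f.1 (a f) (b f)) ∧
    ∀ f v, S f v = b f - a f ⬝ᵥ v.1

/-!
By Yannakakis' theorem, the extension complexity of `P` is at most the nonnegative rank of a slack
matrix of `P`, and a slack matrix has rank at most `n + 1`. So it suffices to bound the nonnegative
rank of a matrix `A` of rank `r` with entries in `{0, …, Δ}`.

Such an `A` has a large monochromatic rectangle. By an optimal design argument the entries of `A`
are inner products of vectors of norm at most `√r` and at most `Δ`. With `ε = 1 / (Δ √r)`, random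
Fourier features then exhibit an affine function of `exp (ε * A i j)` as the probability that a
random rectangle contains `(i, j)`. Intersecting many independent such rectangles favours the larger
entries more and more; the favourite value can change at most `Δ` times, so for some number of
rectangles a single value dominates all the others. This yields a rectangle that is constant up to
few exceptions, and low rank allows the exceptions to be removed. Its density is
`exp (-O(Δ³ √r log r))`.

The ranks of the two blocks sharing their rows or their columns with a monochromatic rectangle add
up to at most `r + 1`, so one of them has about half the rank. Splitting off the rectangle together
with this block removes a fixed proportion of the entries. Iterating until nothing is left bounds
the nonnegative rank for `r` by `exp (O(Δ³ √r log r))` times the one for `r / 2`, and the exponents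
sum to the same order because `√r log r` decreases geometrically.
-/

/-! ### Polyhedra -/

/-- The polyhedron cut out of the affine subspace `L` by the inequalities `0 ≤ y k`; it need not
be bounded, and inequalities may be redundant. -/
def polyhedron {E ι : Type*} [AddCommGroup E] [Module ℝ E] (L : AffineSubspace ℝ E)
    (y : ι → E →ᵃ[ℝ] ℝ) : Set E :=
  {z | z ∈ L ∧ ∀ k, 0 ≤ y k z}

section Polyhedron

open Filter Topology

variable {E ι : Type*} [AddCommGroup E] [Module ℝ E] {L : AffineSubspace ℝ E} {y : ι → E →ᵃ[ℝ] ℝ}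

theorem polyhedron_eq_inter_iInter : polyhedron L y = ↑L ∩ ⋂ k, y k ⁻¹' Set.Ici 0 := by
  ext
  simp [polyhedron]

theorem convex_polyhedron : Convex ℝ (polyhedron L y) :=
  polyhedron_eq_inter_iInter (L := L) ▸
    L.convex.inter (convex_iInter fun k => (convex_Ici 0).affine_preimage (y k))

theorem exists_pos_add_smul_mem_polyhedron [Finite ι] {z u : E} (hz : z ∈ polyhedron L y)
    (hu : u ∈ L.direction) (h : ∀ k, y k z = 0 → (y k).linear u = 0) :
    ∃ ε : ℝ, 0 < ε ∧ z + ε • u ∈ polyhedron L y := by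
  have hy (k : ι) (ε : ℝ) : y k (z + ε • u) = y k z + ε * (y k).linear u := by
    rw [add_comm z, ← vadd_eq_add, AffineMap.map_vadd, map_smul, vadd_eq_add, smul_eq_mul, add_comm]
  have hall : ∀ᶠ ε : ℝ in 𝓝[>] 0, ∀ k, 0 ≤ y k (z + ε • u) := by
    refine eventually_all.2 fun k => ?_
    rcases (hz.2 k).eq_or_lt with hk | hk
    · exact Eventually.of_forall fun ε => by simp [hy, ← hk, h k hk.symm]
    · have hcont : Continuous fun ε : ℝ => y k z + ε * (y k).linear u := by fun_prop
      have hpos : ∀ᶠ ε : ℝ in 𝓝 0, 0 < y k z + ε * (y k).linear u :=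
        continuousAt_const.eventually_lt hcont.continuousAt (by simpa using hk)
      filter_upwards [nhdsWithin_le_nhds hpos] with ε hε
      exact hy k ε ▸ hε.le
  obtain ⟨ε, hε, hpos⟩ := (hall.and self_mem_nhdsWithin).exists
  refine ⟨ε, hpos, ?_, hε⟩
  simpa [add_comm] using AffineSubspace.vadd_mem_of_mem_direction (L.direction.smul_mem ε hu) hz.1

theorem mem_of_isExtreme_polyhedron [Finite ι] {F : Set E} (hF : IsExtreme ℝ (polyhedron L y) F)
    {z z' : E} (hz : z ∈ F) (hz' : z' ∈ polyhedron L y) (h : ∀ k, y k z = 0 → y k z' = 0) :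
    z' ∈ F := by
  obtain ⟨ε, hε, hmem⟩ := exists_pos_add_smul_mem_polyhedron (u := z - z') (hF.1 hz)
    (AffineSubspace.vsub_mem_direction (hF.1 hz).1 hz'.1)
    fun k hk => by rw [← vsub_eq_sub, AffineMap.linearMap_vsub, hk, h k hk, vsub_self]
  refine hF.2 hz' hmem hz
    ⟨ε / (1 + ε), 1 / (1 + ε), by positivity, by positivity, by field_simp; ring, ?_⟩
  have hne : (1 + ε) ≠ 0 := by positivity
  match_scalars
  all_goals field_simp
  all_goals ring

theorem eq_zero_of_mem_extremePoints_polyhedron [Finite ι] {z u : E}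
    (hz : z ∈ (polyhedron L y).extremePoints ℝ) (hu : u ∈ L.direction)
    (h : ∀ k, y k z = 0 → (y k).linear u = 0) : u = 0 := by
  obtain ⟨ε, hε, hmem⟩ := exists_pos_add_smul_mem_polyhedron hz.1 hu h
  have htight (k : ι) (hk : y k z = 0) : y k (z + ε • u) = 0 := by
    rw [add_comm, ← vadd_eq_add, AffineMap.map_vadd, map_smul, h k hk, hk, smul_zero, vadd_eq_add,
      add_zero]
  have := mem_of_isExtreme_polyhedron (isExtreme_singleton.2 hz) rfl hmem htight
  simpa [hε.ne'] using this

theorem finite_extremePoints_polyhedron [Finite ι] : ((polyhedron L y).extremePoints ℝ).Finite :=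
  Set.Finite.of_finite_image (f := fun z => {k | y k z = 0}) (Set.toFinite _)
    fun _z hz _z' hz' heq => (mem_of_isExtreme_polyhedron (isExtreme_singleton.2 hz) rfl hz'.1
      fun k hk => (Set.ext_iff.1 heq k).1 hk).symm

theorem exists_mem_forall_eq_zero [Finite ι] {F : Set E} (hF : Convex ℝ F) (hne : F.Nonempty)
    (hy : ∀ z ∈ F, ∀ k, 0 ≤ y k z) : ∃ z ∈ F, ∀ z' ∈ F, ∀ k, y k z = 0 → y k z' = 0 := by
  suffices h : ∀ s : Set ι, s.Finite → ∃ z ∈ F, ∀ z' ∈ F, ∀ k ∈ s, y k z = 0 → y k z' = 0 by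
    simpa using h Set.univ Set.finite_univ
  intro s hs
  induction s, hs using Set.Finite.induction_on with
  | empty => exact ⟨hne.some, hne.some_mem, by simp⟩
  | @insert j s _ _ ih =>
    obtain ⟨z, hz, hmin⟩ := ih
    by_cases hj : ∀ z' ∈ F, y j z = 0 → y j z' = 0
    · exact ⟨z, hz, fun z' hz' => Set.forall_mem_insert.2 ⟨hj z' hz', hmin z' hz'⟩⟩
    push Not at hj
    obtain ⟨w, hw, -, hjw⟩ := hj
    have hmid (k : ι) : y k (midpoint ℝ z w) = (y k z + y k w) / 2 := by
      rw [AffineMap.map_midpoint, midpoint_eq_smul_add, smul_eq_mul, invOf_eq_inv]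
      ring
    refine ⟨midpoint ℝ z w, hF.midpoint_mem hz hw, fun z' hz' k hk hk0 => ?_⟩
    have hzk := hy z hz k
    have hwk := hy w hw k
    rw [hmid] at hk0
    rcases hk with rfl | hk
    · exact absurd (by linarith) hjw
    · exact hmin z' hz' k hk (by linarith)

end Polyhedron

theorem isClosed_polyhedron {E ι : Type*} [NormedAddCommGroup E] [NormedSpace ℝ E]
    [FiniteDimensional ℝ E] (L : AffineSubspace ℝ E) (y : ι → E →ᵃ[ℝ] ℝ) :
    IsClosed (polyhedron L y) :=
  polyhedron_eq_inter_iInter (L := L) ▸ L.closed_of_finiteDimensional.inter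
    (isClosed_iInter fun k => isClosed_Ici.preimage (y k).continuous_of_finiteDimensional)

theorem convexHull_extremePoints_polyhedron {E ι : Type*} [Finite ι] [AddCommGroup E] [Module ℝ E]
    [TopologicalSpace E] [T2Space E] [IsTopologicalAddGroup E] [ContinuousSMul ℝ E]
    [LocallyConvexSpace ℝ E] {L : AffineSubspace ℝ E} {y : ι → E →ᵃ[ℝ] ℝ}
    (hc : IsCompact (polyhedron L y)) :
    convexHull ℝ ((polyhedron L y).extremePoints ℝ) = polyhedron L y := by
  rw [← (finite_extremePoints_polyhedron.isClosed_convexHull ℝ).closure_eq,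
    closure_convexHull_extremePoints hc convex_polyhedron]

theorem linear_eq_zero_of_mem_vectorSpan {E : Type*} [AddCommGroup E] [Module ℝ E] {F : Set E}
    {f : E →ᵃ[ℝ] ℝ} {b : ℝ} (h : ∀ x ∈ F, f x = b) {v : E} (hv : v ∈ vectorSpan ℝ F) :
    f.linear v = 0 := by
  have hmem : f.linear v ∈ vectorSpan ℝ (f '' F) := by
    rw [← AffineMap.map_vectorSpan]
    exact Submodule.mem_map_of_mem hv
  have hsub : f '' F ⊆ {b} := Set.image_subset_iff.2 h
  simpa using vectorSpan_mono ℝ hsub hmem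

section Facets

variable {d : ℕ} {P F G : Set (Fin d → ℝ)}

theorem affDim_lt_affDim (hGP : G ⊆ P) {f : (Fin d → ℝ) →ᵃ[ℝ] ℝ} {b : ℝ} (hf : ∀ x ∈ G, f x = b)
    {z q : Fin d → ℝ} (hz : z ∈ G) (hq : q ∈ P) (hfq : f q ≠ b) : affDim G < affDim P := by
  refine Submodule.finrank_lt_finrank_of_lt (lt_of_le_of_ne (vectorSpan_mono ℝ hGP) fun heq => ?_)
  have hmem : q -ᵥ z ∈ vectorSpan ℝ G := heq ▸ vsub_mem_vectorSpan ℝ hq (hGP hz)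
  have hzero := linear_eq_zero_of_mem_vectorSpan hf hmem
  rw [AffineMap.linearMap_vsub, hf z hz, vsub_eq_zero_iff_eq] at hzero
  exact hfq hzero

theorem IsFacet.eq_of_subset (hF : IsFacet P F) (hFG : F ⊆ G) (hGP : G ⊆ P)
    (hdim : affDim G < affDim P) : F = G := by
  obtain ⟨hne, hexp, hdimF⟩ := hF
  obtain ⟨l, hl⟩ := hexp hne
  obtain ⟨z, hz⟩ := hne
  have hspan : vectorSpan ℝ F = vectorSpan ℝ G :=
    Submodule.eq_of_le_of_finrank_le (vectorSpan_mono ℝ hFG) (by unfold affDim at hdimF hdim; omega)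
  have hlF : ∀ x ∈ F, l.toLinearMap.toAffineMap x = l z := fun x hx =>
    le_antisymm ((hl ▸ hz : z ∈ {x ∈ P | ∀ y ∈ P, l y ≤ l x}).2 x (hexp.subset hx))
      ((hl ▸ hx : x ∈ {x ∈ P | ∀ y ∈ P, l y ≤ l x}).2 z (hexp.subset hz))
  refine hFG.antisymm fun g hg => ?_
  have hgz : l g = l z := by
    have := linear_eq_zero_of_mem_vectorSpan hlF (hspan ▸ vsub_mem_vectorSpan ℝ hg (hFG hz))
    simpa [sub_eq_zero] using this
  rw [hl] at hz ⊢
  exact ⟨hGP hg, fun w hw => hgz ▸ hz.2 w hw⟩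

variable {ι : Type*} [Finite ι] {L : AffineSubspace ℝ (Fin d → ℝ)}
  {y : ι → (Fin d → ℝ) →ᵃ[ℝ] ℝ}

theorem isPolytope_polyhedron (hc : IsCompact (polyhedron L y)) : IsPolytope (polyhedron L y) :=
  ⟨_, finite_extremePoints_polyhedron, (convexHull_extremePoints_polyhedron hc).symm⟩

theorem IsFacet.exists_eq_setOf_eq_zero (hF : IsFacet (polyhedron L y) F) :
    ∃ k, F = {z ∈ polyhedron L y | y k z = 0} := by
  have hFQ := hF.2.1.subset
  obtain ⟨z, hz, hmin⟩ := exists_mem_forall_eq_zero (hF.2.1.convex convex_polyhedron) hF.1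
    fun z hz => (hFQ hz).2
  obtain ⟨k, hk, q, hq, hkq⟩ : ∃ k, y k z = 0 ∧ ∃ q ∈ polyhedron L y, y k q ≠ 0 := by
    by_contra! hall
    have hFeq : F = polyhedron L y := hFQ.antisymm fun q hq =>
      mem_of_isExtreme_polyhedron hF.2.1.isExtreme hz hq fun k hk => hall k hk q hq
    have hdim := hF.2.2
    rw [hFeq] at hdim
    omega
  exact ⟨k, hF.eq_of_subset (fun z' hz' => ⟨hFQ hz', hmin z' hz' k hk⟩) (Set.sep_subset _ _)
    (affDim_lt_affDim (Set.sep_subset _ _) (fun x hx => hx.2) ⟨hFQ hz, hk⟩ hq hkq)⟩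

theorem encard_isFacet_polyhedron_le :
    {F | IsFacet (polyhedron L y) F}.encard ≤ Nat.card ι := by
  have hsub : {F | IsFacet (polyhedron L y) F} ⊆
      (fun k => {z ∈ polyhedron L y | y k z = 0}) '' Set.univ := fun F hF => by
    obtain ⟨k, hk⟩ := hF.exists_eq_setOf_eq_zero
    exact ⟨k, trivial, hk.symm⟩
  calc {F | IsFacet (polyhedron L y) F}.encard
      ≤ (Set.univ : Set ι).encard := (Set.encard_le_encard hsub).trans (Set.encard_image_le _ _)
    _ = Nat.card ι := by rw [Set.encard_univ, ENat.card_eq_coe_natCard]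

end Facets

/-! ### The facet description of a polytope -/

/-- The polar `{f | ∀ i, f (v i) ≤ 1}` of a family of vectors, as a polyhedron in the dual. -/
def familyPolar {E ι : Type*} [NormedAddCommGroup E] [NormedSpace ℝ E] (v : ι → E) :
    Set (StrongDual ℝ E) :=
  polyhedron ⊤ fun i => AffineMap.const ℝ (StrongDual ℝ E) 1 -
    (ContinuousLinearMap.apply ℝ ℝ (v i)).toLinearMap.toAffineMap

section Polar

variable {E ι : Type*} [NormedAddCommGroup E] [NormedSpace ℝ E] {v : ι → E}

theorem mem_familyPolar {f : StrongDual ℝ E} : f ∈ familyPolar v ↔ ∀ i, f (v i) ≤ 1 := by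
  simp [familyPolar, polyhedron]

theorem exists_mem_familyPolar_one_lt [Fintype ι] [Nonempty ι] (hsum : ∑ i, v i = 0) {x : E}
    (hx : x ∉ convexHull ℝ (Set.range v)) : ∃ f ∈ familyPolar v, 1 < f x := by
  obtain ⟨f, u, hf, hu⟩ := geometric_hahn_banach_closed_point (convex_convexHull ℝ _)
    ((Set.finite_range v).isClosed_convexHull ℝ) hx
  have hfv (i : ι) : f (v i) < u := hf _ (subset_convexHull ℝ _ ⟨i, rfl⟩)
  have hu0 : 0 < u := by
    have hlt := Finset.sum_lt_sum_of_nonempty Finset.univ_nonempty fun i _ => hfv i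
    rw [← map_sum, hsum, map_zero, Finset.sum_const, nsmul_eq_mul] at hlt
    exact pos_of_mul_pos_right hlt (Nat.cast_nonneg _)
  refine ⟨u⁻¹ • f, mem_familyPolar.2 fun i => ?_, ?_⟩
  · simpa [inv_mul_le_iff₀ hu0] using (hfv i).le
  · simpa [lt_inv_mul_iff₀ hu0] using hu

variable [FiniteDimensional ℝ E]

theorem span_eq_top_of_mem_extremePoints_familyPolar [Finite ι] {f : StrongDual ℝ E}
    (hf : f ∈ (familyPolar v).extremePoints ℝ) :
    Submodule.span ℝ (v '' {i | f (v i) = 1}) = ⊤ := by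
  by_contra hspan
  obtain ⟨u, hu, hker⟩ := Submodule.exists_le_ker_of_lt_top _ (lt_top_iff_ne_top.2 hspan)
  have hzero : LinearMap.toContinuousLinearMap u = 0 := by
    refine eq_zero_of_mem_extremePoints_polyhedron hf (by simp) fun i hi => ?_
    have hi : f (v i) = 1 := (sub_eq_zero.1 hi).symm
    have hui : u (v i) = 0 := hker (Submodule.subset_span ⟨i, hi, rfl⟩)
    simpa using hui
  exact hu (by simpa using hzero)

variable [Fintype ι]

theorem isCompact_familyPolar (hspan : Submodule.span ℝ (Set.range v) = ⊤)
    (hsum : ∑ i, v i = 0) : IsCompact (familyPolar v) := by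
  let eval : StrongDual ℝ E →ₗ[ℝ] ι → ℝ :=
    LinearMap.pi fun i => (ContinuousLinearMap.apply ℝ ℝ (v i)).toLinearMap
  have hinj : Function.Injective eval := fun f g hfg =>
    ContinuousLinearMap.coe_injective (LinearMap.ext_on_range hspan (congrFun hfg))
  have hemb := LinearMap.isClosedEmbedding_of_injective (LinearMap.ker_eq_bot.2 hinj)
  have hbox : IsCompact (Set.univ.pi fun _ : ι => Set.Icc (-(Fintype.card ι : ℝ)) 1) :=
    isCompact_univ_pi fun _ => isCompact_Icc
  refine (hemb.isCompact_preimage hbox).of_isClosed_subset (isClosed_polyhedron _ _)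
    fun f hf i _ => ⟨?_, mem_familyPolar.1 hf i⟩
  classical
  have hfsum : f (v i) + ∑ j ∈ Finset.univ.erase i, f (v j) = 0 := by
    rw [Finset.add_sum_erase _ (fun j => f (v j)) (Finset.mem_univ i), ← map_sum, hsum, map_zero]
  have hle : ∑ j ∈ Finset.univ.erase i, f (v j) ≤ Fintype.card ι :=
    (Finset.sum_le_card_nsmul _ _ 1 fun j _ => mem_familyPolar.1 hf j).trans (by simp)
  change -(Fintype.card ι : ℝ) ≤ f (v i)
  linarith

theorem exists_forall_le_one_and_span_eq_top [Nonempty ι]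
    (hspan : Submodule.span ℝ (Set.range v) = ⊤) (hsum : ∑ i, v i = 0) {x : E}
    (hx : x ∉ convexHull ℝ (Set.range v)) :
    ∃ f : StrongDual ℝ E, (∀ i, f (v i) ≤ 1) ∧ 1 < f x ∧
      Submodule.span ℝ (v '' {i | f (v i) = 1}) = ⊤ := by
  obtain ⟨g, hg, hgx⟩ := exists_mem_familyPolar_one_lt hsum hx
  obtain ⟨f, hf, hfx⟩ : ∃ f ∈ (familyPolar v).extremePoints ℝ, 1 < f x := by
    by_contra! hall
    have hconv : Convex ℝ {f : StrongDual ℝ E | f x ≤ 1} :=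
      convex_halfSpace_le (ContinuousLinearMap.apply ℝ ℝ x).toLinearMap.isLinear 1
    have hsub := convexHull_min hall hconv
    rw [familyPolar, convexHull_extremePoints_polyhedron (isCompact_familyPolar hspan hsum)] at hsub
    exact hgx.not_ge (hsub hg)
  exact ⟨f, mem_familyPolar.1 hf.1, hfx, span_eq_top_of_mem_extremePoints_familyPolar hf⟩

end Polar

theorem exists_forall_le_one_and_span_eq_span {E ι : Type*} [NormedAddCommGroup E] [NormedSpace ℝ E]
    [Fintype ι] [Nonempty ι] {v : ι → E} (hsum : ∑ i, v i = 0) {x : E}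
    (hxspan : x ∈ Submodule.span ℝ (Set.range v)) (hx : x ∉ convexHull ℝ (Set.range v)) :
    ∃ f : StrongDual ℝ E, (∀ i, f (v i) ≤ 1) ∧ 1 < f x ∧
      Submodule.span ℝ (v '' {i | f (v i) = 1}) = Submodule.span ℝ (Set.range v) := by
  let W := Submodule.span ℝ (Set.range v)
  have : FiniteDimensional ℝ W := FiniteDimensional.span_of_finite ℝ (Set.finite_range v)
  let w : ι → W := fun i => ⟨v i, Submodule.subset_span ⟨i, rfl⟩⟩
  have hwv (s : Set ι) : W.subtype '' (w '' s) = v '' s := Set.image_image _ _ _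
  have hspan : Submodule.span ℝ (Set.range w) = ⊤ := by
    refine Submodule.map_injective_of_injective W.subtype_injective ?_
    rw [Submodule.map_span, ← Set.image_univ, hwv, Set.image_univ, Submodule.map_subtype_top]
  have hxw : (⟨x, hxspan⟩ : W) ∉ convexHull ℝ (Set.range w) := fun hmem => hx <| by
    have := Set.mem_image_of_mem W.subtype hmem
    rwa [W.subtype.image_convexHull, ← Set.image_univ, hwv, Set.image_univ] at this
  obtain ⟨f, hf, hfx, hfspan⟩ :=
    exists_forall_le_one_and_span_eq_top hspan (Subtype.ext (by simpa [w] using hsum)) hxw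
  obtain ⟨g, hg, -⟩ := exists_extension_norm_eq W f
  have hgv (i : ι) : g (v i) = f (w i) := hg (w i)
  refine ⟨g, fun i => hgv i ▸ hf i, (hg ⟨x, hxspan⟩).symm ▸ hfx, ?_⟩
  simp only [hgv]
  rw [← hwv, ← Submodule.map_span, hfspan, Submodule.map_subtype_top]

theorem exists_mem_convexHull_sum_sub_eq_zero {E ι : Type*} [AddCommGroup E] [Module ℝ E]
    [Fintype ι] [Nonempty ι] (v : ι → E) :
    ∃ p ∈ convexHull ℝ (Set.range v), ∑ i, (v i - p) = 0 := by
  refine ⟨Finset.univ.centerMass (fun _ => (1 : ℝ)) v,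
    Finset.centerMass_mem_convexHull _ (by simp) (by simp [Fintype.card_pos]) (by simp), ?_⟩
  simp [Finset.centerMass, ← Nat.cast_smul_eq_nsmul ℝ]

theorem span_range_sub_eq_vectorSpan {E ι : Type*} [AddCommGroup E] [Module ℝ E] {v : ι → E} {p : E}
    (hp : p ∈ affineSpan ℝ (Set.range v)) :
    Submodule.span ℝ (Set.range fun i => v i - p) = vectorSpan ℝ (Set.range v) := by
  refine le_antisymm (Submodule.span_le.2 ?_) (Submodule.span_le.2 ?_)
  · rintro _ ⟨i, rfl⟩
    rw [← direction_affineSpan]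
    exact AffineSubspace.vsub_mem_direction (mem_affineSpan ℝ ⟨i, rfl⟩) hp
  · rintro _ ⟨_, ⟨i, rfl⟩, _, ⟨j, rfl⟩, rfl⟩
    have hij := sub_mem (Submodule.subset_span (R := ℝ) (Set.mem_range_self (f := (v · - p)) i))
      (Submodule.subset_span (R := ℝ) (Set.mem_range_self j))
    simpa using hij

open scoped Pointwise in
theorem exists_forall_le_one_and_span_eq_vectorSpan {E ι : Type*} [NormedAddCommGroup E]
    [NormedSpace ℝ E] [Fintype ι] {v : ι → E} {p : E} (hp : p ∈ affineSpan ℝ (Set.range v))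
    (hsum : ∑ i, (v i - p) = 0) {x : E} (hxspan : x ∈ affineSpan ℝ (Set.range v))
    (hx : x ∉ convexHull ℝ (Set.range v)) :
    ∃ f : StrongDual ℝ E, (∀ i, f (v i - p) ≤ 1) ∧ 1 < f (x - p) ∧
      Submodule.span ℝ ((fun i => v i - p) '' {i | f (v i - p) = 1}) =
        vectorSpan ℝ (Set.range v) := by
  have : Nonempty ι := Set.range_nonempty_iff_nonempty.1 ((affineSpan_nonempty ℝ).1 ⟨x, hxspan⟩)
  rw [← span_range_sub_eq_vectorSpan hp]
  refine exists_forall_le_one_and_span_eq_span hsum ?_ fun hmem => hx ?_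
  · rw [span_range_sub_eq_vectorSpan hp, ← direction_affineSpan]
    exact AffineSubspace.vsub_mem_direction hxspan hp
  · have hrange : (Set.range fun i => v i - p) = -p +ᵥ Set.range v := by
      rw [← Set.image_vadd, ← Set.range_comp]
      simp [Function.comp_def, sub_eq_neg_add]
    rwa [hrange, convexHull_vadd, sub_eq_neg_add, ← vadd_eq_add, Set.vadd_mem_vadd_set_iff] at hmem

theorem finrank_sup_span_singleton {K V : Type*} [DivisionRing K] [AddCommGroup V] [Module K V]
    (W : Submodule K V) [FiniteDimensional K W] {w : V} (hw : w ∉ W) :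
    Module.finrank K ↥(W ⊔ Submodule.span K {w}) = Module.finrank K W + 1 := by
  have hw0 : w ≠ 0 := fun h => hw (h ▸ W.zero_mem)
  have hdisj : W ⊓ Submodule.span K {w} = ⊥ :=
    ((Submodule.disjoint_span_singleton' hw0).2 hw).eq_bot
  have h := Submodule.finrank_sup_add_finrank_inf_eq W (Submodule.span K {w})
  rwa [hdisj, finrank_bot, add_zero, finrank_span_singleton hw0] at h

theorem span_image_sub_eq_vectorSpan_sup {E : Type*} [AddCommGroup E] [Module ℝ E] {F : Set E}
    {p q : E} (hq : q ∈ F) :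
    Submodule.span ℝ ((· - p) '' F) = vectorSpan ℝ F ⊔ Submodule.span ℝ {q - p} := by
  have hsub {z : E} (hz : z ∈ F) : z - p ∈ Submodule.span ℝ ((· - p) '' F) :=
    Submodule.subset_span ⟨z, hz, rfl⟩
  refine le_antisymm (Submodule.span_le.2 ?_) (sup_le (Submodule.span_le.2 ?_) ?_)
  · rintro _ ⟨z, hz, rfl⟩
    exact Submodule.mem_sup.2 ⟨z - q, vsub_mem_vectorSpan ℝ hz hq, q - p,
      Submodule.mem_span_singleton_self _, sub_add_sub_cancel _ _ _⟩
  · rintro _ ⟨z, hz, z', hz', rfl⟩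
    simpa using sub_mem (hsub hz) (hsub hz')
  · exact (Submodule.span_singleton_le_iff_mem _ _).2 (hsub hq)

section FacetDescription

variable {d : ℕ} {P : Set (Fin d → ℝ)}

theorem IsPolytope.isCompact (hP : IsPolytope P) : IsCompact P := by
  obtain ⟨s, hs, rfl⟩ := hP
  exact hs.isCompact_convexHull ℝ

theorem IsPolytope.convex (hP : IsPolytope P) : Convex ℝ P := by
  obtain ⟨s, -, rfl⟩ := hP
  exact convex_convexHull ℝ s

theorem IsPolytope.finite_extremePoints (hP : IsPolytope P) : (P.extremePoints ℝ).Finite := by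
  obtain ⟨s, hs, rfl⟩ := hP
  exact hs.subset extremePoints_convexHull_subset

theorem IsPolytope.convexHull_extremePoints (hP : IsPolytope P) :
    convexHull ℝ (P.extremePoints ℝ) = P := by
  rw [← (hP.finite_extremePoints.isClosed_convexHull ℝ).closure_eq,
    closure_convexHull_extremePoints hP.isCompact hP.convex]

theorem dotProduct_eq_zero_of_mem_vectorSpan {F : Set (Fin d → ℝ)} {a : Fin d → ℝ} {b : ℝ}
    (h : ∀ x ∈ F, a ⬝ᵥ x = b) {v : Fin d → ℝ} (hv : v ∈ vectorSpan ℝ F) : a ⬝ᵥ v = 0 :=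
  linear_eq_zero_of_mem_vectorSpan (f := (dotProductBilin ℝ ℝ a).toAffineMap) h hv

theorem isFacet_setOf_apply_sub_eq_one {p : Fin d → ℝ} {f : StrongDual ℝ (Fin d → ℝ)}
    (hf : ∀ z ∈ P, f (z - p) ≤ 1) (hne : {z ∈ P | f (z - p) = 1}.Nonempty)
    (hspan : Submodule.span ℝ ((· - p) '' {z ∈ P | f (z - p) = 1}) = vectorSpan ℝ P) :
    IsFacet P {z ∈ P | f (z - p) = 1} := by
  refine ⟨hne, fun _ => ⟨f, ?_⟩, ?_⟩
  all_goals obtain ⟨q, hq⟩ := hne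
  · ext z
    simp only [Set.mem_ofPred_eq, and_congr_right_iff]
    refine fun hz => ⟨fun h w hw => ?_, fun h => le_antisymm (hf z hz) ?_⟩
    · have hwz := (hf w hw).trans h.ge
      simpa only [map_sub, sub_le_sub_iff_right] using hwz
    · rw [← hq.2, map_sub, map_sub]
      exact sub_le_sub_right (h q hq.1) _
  · have hnot : q - p ∉ vectorSpan ℝ {z ∈ P | f (z - p) = 1} := fun hmem => by
      have hconst : ∀ z ∈ {z ∈ P | f (z - p) = 1}, f.toLinearMap.toAffineMap z = 1 + f p :=
        fun z hz => by simpa [sub_eq_iff_eq_add] using hz.2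
      have hzero := linear_eq_zero_of_mem_vectorSpan hconst hmem
      exact one_ne_zero (hq.2.symm.trans hzero)
    rw [affDim, affDim, ← hspan, span_image_sub_eq_vectorSpan_sup hq,
      finrank_sup_span_singleton _ hnot]

theorem IsPolytope.exists_functional_of_notMem (hP : IsPolytope P) {x : Fin d → ℝ}
    (hxspan : x ∈ affineSpan ℝ P) (hx : x ∉ P) :
    ∃ p ∈ P, ∃ f : StrongDual ℝ (Fin d → ℝ), (∀ z ∈ P, f (z - p) ≤ 1) ∧ 1 < f (x - p) ∧
      Submodule.span ℝ ((· - p) '' {z ∈ P | f (z - p) = 1}) = vectorSpan ℝ P := by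
  obtain ⟨s, hs, rfl⟩ := hP
  have : Fintype s := hs.fintype
  rw [affineSpan_convexHull] at hxspan
  have : Nonempty s := ((affineSpan_nonempty ℝ).1 ⟨x, hxspan⟩).to_subtype
  obtain ⟨p, hp, hsum⟩ := exists_mem_convexHull_sum_sub_eq_zero ((↑) : s → Fin d → ℝ)
  obtain ⟨f, hf, hfx, hspan⟩ := exists_forall_le_one_and_span_eq_vectorSpan
    (convexHull_subset_affineSpan _ hp) hsum (x := x) (by simpa using hxspan) (by simpa using hx)
  rw [Subtype.range_coe] at hp hspan
  have hconv : Convex ℝ {z | f z ≤ 1 + f p} := convex_halfSpace_le f.toLinearMap.isLinear _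
  have hle : ∀ z ∈ convexHull ℝ s, f (z - p) ≤ 1 := fun z hz => by
    have hfs : s ⊆ {z | f z ≤ 1 + f p} := fun z hz => by
      simpa [sub_le_iff_le_add] using hf ⟨z, hz⟩
    simpa [sub_le_iff_le_add] using convexHull_min hfs hconv hz
  refine ⟨p, hp, f, hle, hfx, le_antisymm (Submodule.span_le.2 ?_) ?_⟩
  · rintro _ ⟨z, hz, rfl⟩
    exact vsub_mem_vectorSpan ℝ hz.1 hp
  · rw [← direction_affineSpan, affineSpan_convexHull, direction_affineSpan, ← hspan]
    refine Submodule.span_mono ?_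
    rintro _ ⟨z, hz, rfl⟩
    exact ⟨z, ⟨subset_convexHull ℝ s z.2, hz⟩, rfl⟩

theorem IsPolytope.exists_isFacet_of_notMem (hP : IsPolytope P) {x : Fin d → ℝ}
    (hxspan : x ∈ affineSpan ℝ P) (hx : x ∉ P) :
    ∃ F, IsFacet P F ∧ ∃ p ∈ P, p ∉ F ∧ ∃ q ∈ F, ∃ t : ℝ, 1 < t ∧
      x - p - t • (q - p) ∈ vectorSpan ℝ F := by
  obtain ⟨p, hp, f, hf, hfx, hspan⟩ := hP.exists_functional_of_notMem hxspan hx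
  have hxp : x - p ∈ vectorSpan ℝ P := by
    rw [← direction_affineSpan]
    exact AffineSubspace.vsub_mem_direction hxspan (mem_affineSpan ℝ hp)
  rw [← hspan] at hxp
  obtain hempty | ⟨q, hq⟩ := {z ∈ P | f (z - p) = 1}.eq_empty_or_nonempty
  · rw [hempty, Set.image_empty, Submodule.span_empty, Submodule.mem_bot] at hxp
    exact absurd hfx (by simp [hxp])
  refine ⟨_, isFacet_setOf_apply_sub_eq_one hf ⟨q, hq⟩ hspan, p, hp, by simp, q, hq, ?_⟩
  rw [span_image_sub_eq_vectorSpan_sup hq, Submodule.mem_sup] at hxp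
  obtain ⟨w, hw, _, hz, hwz⟩ := hxp
  obtain ⟨t, rfl⟩ := Submodule.mem_span_singleton.1 hz
  have hconst : ∀ z ∈ {z ∈ P | f (z - p) = 1}, f.toLinearMap.toAffineMap z = 1 + f p :=
    fun z hz => by simpa [sub_eq_iff_eq_add] using hz.2
  have hfw : f w = 0 := linear_eq_zero_of_mem_vectorSpan hconst hw
  refine ⟨t, ?_, by rwa [← hwz, add_sub_cancel_right]⟩
  rwa [← hwz, map_add, hfw, map_smul, hq.2, smul_eq_mul, mul_one, zero_add] at hfx

theorem IsPolytope.mem_of_facet_inequalities (hP : IsPolytope P) {x : Fin d → ℝ}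
    (hx : x ∈ affineSpan ℝ P) (h : ∀ F, IsFacet P F → ∃ a b, DefinesFace P F a b ∧ a ⬝ᵥ x ≤ b) :
    x ∈ P := by
  by_contra hxP
  obtain ⟨F, hF, p, hp, hpF, q, hq, t, ht, hmem⟩ := hP.exists_isFacet_of_notMem hx hxP
  obtain ⟨a, b, ⟨hab, rfl⟩, hax⟩ := h F hF
  have hpb : a ⬝ᵥ p < b := lt_of_le_of_ne (hab p hp) fun h => hpF ⟨hp, h⟩
  have hzero := dotProduct_eq_zero_of_mem_vectorSpan (fun z hz => hz.2) hmem
  simp only [dotProduct_sub, dotProduct_smul, smul_eq_mul, hq.2] at hzero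
  nlinarith

end FacetDescription

/-! ### Extended formulations -/

/-- The nonnegative rank of `M` is at most `N`. -/
def NonnegRankLE {I J : Type*} (M : Matrix I J ℝ) (N : ℕ) : Prop :=
  ∃ (U : Matrix I (Fin N) ℝ) (W : Matrix (Fin N) J ℝ),
    (∀ i k, 0 ≤ U i k) ∧ (∀ k j, 0 ≤ W k j) ∧ M = U * W

theorem extensionComplexity_le_of_isCompact_polyhedron {d : ℕ} {E ι : Type*}
    [NormedAddCommGroup E] [NormedSpace ℝ E] [FiniteDimensional ℝ E] [Finite ι]
    {L : AffineSubspace ℝ E} {y : ι → E →ᵃ[ℝ] ℝ} (hc : IsCompact (polyhedron L y))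
    (π : E →ₗ[ℝ] Fin d → ℝ) : extensionComplexity (π '' polyhedron L y) ≤ Nat.card ι := by
  let e : E ≃ₗ[ℝ] (Fin (Module.finrank ℝ E) → ℝ) := (Module.finBasis ℝ E).equivFun
  let g : (Fin (Module.finrank ℝ E) → ℝ) →ᵃ[ℝ] E := e.symm.toLinearMap.toAffineMap
  have himage : polyhedron (L.comap g) (fun k => (y k).comp g) = e '' polyhedron L y := by
    ext z
    rw [e.image_eq_preimage_symm]
    rfl
  have hcompact : IsCompact (polyhedron (L.comap g) fun k => (y k).comp g) :=
    himage ▸ hc.image e.toLinearMap.continuous_of_finiteDimensional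
  refine le_trans (sInf_le ?_) (encard_isFacet_polyhedron_le (L := L.comap g)
    (y := fun k => (y k).comp g))
  refine ⟨_, _, π ∘ₗ e.symm.toLinearMap, isPolytope_polyhedron hcompact, ?_, rfl⟩
  rw [himage, ← Set.image_comp]
  simp [Function.comp_def]

/-- The extended formulation `{(x, y) | x ∈ L, A x + U y = b, 0 ≤ y}` attached to a factorization
`b - A x = U y` of slacks. -/
def slackExtension {I κ ν : Type*} [Fintype κ] [Fintype ν] (L : AffineSubspace ℝ (ν → ℝ))
    (A : Matrix I ν ℝ) (b : I → ℝ) (U : Matrix I κ ℝ) : Set ((ν → ℝ) × (κ → ℝ)) :=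
  polyhedron (L.comap (LinearMap.fst ℝ (ν → ℝ) (κ → ℝ)).toAffineMap ⊓
      (AffineSubspace.comap (A.mulVecLin.coprod U.mulVecLin).toAffineMap (AffineSubspace.mk' b ⊥)))
    fun k => (LinearMap.proj k ∘ₗ LinearMap.snd ℝ (ν → ℝ) (κ → ℝ)).toAffineMap

theorem mem_slackExtension {I κ ν : Type*} [Fintype κ] [Fintype ν] {L : AffineSubspace ℝ (ν → ℝ)}
    {A : Matrix I ν ℝ} {b : I → ℝ} {U : Matrix I κ ℝ} {z : (ν → ℝ) × (κ → ℝ)} :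
    z ∈ slackExtension L A b U ↔
      z.1 ∈ L ∧ A.mulVec z.1 + U.mulVec z.2 = b ∧ ∀ k, 0 ≤ z.2 k := by
  simp [slackExtension, polyhedron, AffineSubspace.mem_inf_iff, sub_eq_zero, and_assoc]

section SlackExtension

variable {d : ℕ} {I κ : Type*} [Fintype κ] {P : Set (Fin d → ℝ)} {L : AffineSubspace ℝ (Fin d → ℝ)}
  {A : Matrix I (Fin d) ℝ} {b : I → ℝ} {U : Matrix I κ ℝ}

theorem isCompact_slackExtension (hP : IsCompact P) (hU : ∀ i k, 0 ≤ U i k)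
    (hpos : ∀ k, ∃ i, 0 < U i k) (hfst : ∀ z ∈ slackExtension L A b U, z.1 ∈ P) :
    IsCompact (slackExtension L A b U) := by
  choose i hi using hpos
  have hcont (k : κ) : Continuous fun x => (b (i k) - A.mulVec x (i k)) / U (i k) k := by fun_prop
  choose c hc using fun k => (hP.image (hcont k)).bddAbove
  refine (hP.prod (isCompact_univ_pi fun k => isCompact_Icc (a := 0) (b := c k))).of_isClosed_subset
    (isClosed_polyhedron _ _) fun z hz => ⟨hfst z hz, fun k _ => ?_⟩
  obtain ⟨-, heq, hnonneg⟩ := mem_slackExtension.1 hz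
  refine ⟨hnonneg k, le_trans ?_ (hc k ⟨z.1, hfst z hz, rfl⟩)⟩
  have hterm : U (i k) k * z.2 k ≤ U.mulVec z.2 (i k) :=
    Finset.single_le_sum (f := fun k' => U (i k) k' * z.2 k')
      (fun k' _ => mul_nonneg (hU _ _) (hnonneg k')) (Finset.mem_univ k)
  rw [le_div_iff₀ (hi k), ← heq, Pi.add_apply, add_sub_cancel_left, mul_comm]
  exact hterm

theorem fst_image_slackExtension
    {U : Matrix {F : Set (Fin d → ℝ) // IsFacet P F} κ ℝ} {W : Matrix κ (P.extremePoints ℝ) ℝ}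
    {A : Matrix {F : Set (Fin d → ℝ) // IsFacet P F} (Fin d) ℝ}
    {b : {F : Set (Fin d → ℝ) // IsFacet P F} → ℝ} (hP : IsPolytope P)
    (hface : ∀ f, DefinesFace P f.1 (A f) (b f)) (hU : ∀ f k, 0 ≤ U f k) (hW : ∀ k v, 0 ≤ W k v)
    (hUW : ∀ f v, b f - A f ⬝ᵥ v.1 = (U * W) f v) :
    Prod.fst '' slackExtension (affineSpan ℝ P) A b U = P := by
  refine Set.Subset.antisymm ?_ ?_
  · rintro _ ⟨z, hz, rfl⟩
    obtain ⟨hspan, heq, hnonneg⟩ := mem_slackExtension.1 hz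
    refine hP.mem_of_facet_inequalities hspan fun F hF => ⟨_, _, hface ⟨F, hF⟩, ?_⟩
    rw [← heq]
    exact le_add_of_nonneg_right (Finset.sum_nonneg fun k _ => mul_nonneg (hU _ k) (hnonneg k))
  · conv_lhs => rw [← hP.convexHull_extremePoints]
    have hconv : Convex ℝ (LinearMap.fst ℝ _ _ '' slackExtension (affineSpan ℝ P) A b U) :=
      convex_polyhedron.linear_image _
    refine convexHull_min (fun v hv => ?_) hconv
    refine ⟨(v, fun k => W k ⟨v, hv⟩), mem_slackExtension.2
      ⟨mem_affineSpan ℝ hv.1, funext fun f => ?_, fun k => hW k _⟩, rfl⟩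
    rw [Pi.add_apply, add_comm, ← eq_sub_iff_add_eq]
    exact (hUW f ⟨v, hv⟩).symm

end SlackExtension

theorem NonnegRankLE.exists_pos_factorization {I J : Type*} {M : Matrix I J ℝ} {N : ℕ}
    (hM : NonnegRankLE M N) : ∃ (κ : Type) (_ : Fintype κ) (U : Matrix I κ ℝ) (W : Matrix κ J ℝ),
      Fintype.card κ ≤ N ∧ (∀ i k, 0 ≤ U i k) ∧ (∀ k j, 0 ≤ W k j) ∧ (∀ k, ∃ i, 0 < U i k) ∧
        M = U * W := by
  classical
  obtain ⟨U, W, hU, hW, rfl⟩ := hM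
  refine ⟨{k // ∃ i, 0 < U i k}, inferInstance, U.submatrix id (↑), W.submatrix (↑) id,
    (Fintype.card_subtype_le _).trans_eq (Fintype.card_fin N), fun i k => hU i k,
    fun k j => hW k j, fun k => k.2, ?_⟩
  ext i j
  have hzero : ∑ k : {k // ¬∃ i, 0 < U i k}, U i k * W k j = 0 :=
    Finset.sum_eq_zero fun k _ => by
      rw [le_antisymm (not_lt.1 fun h => k.2 ⟨i, h⟩) (hU i k), zero_mul]
  have hsplit := Fintype.sum_subtype_add_sum_subtype (fun k => ∃ i, 0 < U i k)
    fun k => U i k * W k j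
  rw [hzero, add_zero] at hsplit
  exact hsplit.symm

theorem extensionComplexity_le_of_nonnegRankLE {d N : ℕ} {P : Set (Fin d → ℝ)} (hP : IsPolytope P)
    {S : Matrix {F : Set (Fin d → ℝ) // IsFacet P F} (P.extremePoints ℝ) ℝ}
    (hS : IsSlackMatrix P S) (hN : NonnegRankLE S N) : extensionComplexity P ≤ N := by
  obtain ⟨A, b, hface, hSab⟩ := hS
  obtain ⟨κ, _, U, W, hcard, hU, hW, hpos, rfl⟩ := hN.exists_pos_factorization
  have hfst := fst_image_slackExtension hP hface hU hW fun f v => (hSab f v).symm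
  have hcompact := isCompact_slackExtension hP.isCompact hU hpos
    fun z hz => hfst.le (Set.mem_image_of_mem _ hz)
  calc extensionComplexity P
      = extensionComplexity (LinearMap.fst ℝ _ _ '' slackExtension (affineSpan ℝ P) A b U) :=
        congrArg _ hfst.symm
    _ ≤ Nat.card κ := extensionComplexity_le_of_isCompact_polyhedron hcompact _
    _ ≤ N := by exact_mod_cast Nat.card_eq_fintype_card.trans_le hcard

/-! ### Mixtures of rectangles -/

section RectangleMixture

open MeasureTheory ProbabilityTheory RealInnerProductSpace

variable {I J : Type*}

/-- `K` is a convex combination of indicator functions of combinatorial rectangles: the entry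
`K i j` is the probability that a suitable random rectangle contains `(i, j)`. -/
def IsRectangleMixture (K : I → J → ℝ) : Prop :=
  K ∈ convexHull ℝ (Set.range fun (R : Set I × Set J) i j =>
    R.1.indicator 1 i * R.2.indicator 1 j)

theorem isRectangleMixture_indicator (A : Set I) (B : Set J) :
    IsRectangleMixture fun i j => A.indicator 1 i * B.indicator 1 j :=
  subset_convexHull ℝ _ ⟨(A, B), rfl⟩

theorem isRectangleMixture_one : IsRectangleMixture (1 : I → J → ℝ) := by
  convert isRectangleMixture_indicator (Set.univ : Set I) (Set.univ : Set J) using 1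
  ext i j
  simp

theorem IsRectangleMixture.midpoint {K K' : I → J → ℝ} (hK : IsRectangleMixture K)
    (hK' : IsRectangleMixture K') : IsRectangleMixture (midpoint ℝ K K') :=
  (convex_convexHull ℝ _).midpoint_mem hK hK'

theorem isRectangleMixture_map_of_mem_convexHull {V : Type*} [AddCommGroup V] [Module ℝ V]
    {s : Set V} {x : V} (f : V →ₗ[ℝ] I → J → ℝ) (hf : ∀ y ∈ s, IsRectangleMixture (f y))
    (hx : x ∈ convexHull ℝ s) : IsRectangleMixture (f x) :=
  convexHull_min (t := f ⁻¹' {K | IsRectangleMixture K}) hf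
    ((convex_convexHull ℝ _).linear_preimage f) hx

/-- Intersect two independent random rectangles. -/
theorem IsRectangleMixture.mul {K K' : I → J → ℝ} (hK : IsRectangleMixture K)
    (hK' : IsRectangleMixture K') : IsRectangleMixture (K * K') := by
  refine isRectangleMixture_map_of_mem_convexHull (LinearMap.mulRight ℝ K')
    (Set.forall_mem_range.2 fun R => ?_) hK
  refine isRectangleMixture_map_of_mem_convexHull (LinearMap.mulLeft ℝ _)
    (Set.forall_mem_range.2 fun R' => ?_) hK'
  convert isRectangleMixture_indicator (R.1 ∩ R'.1) (R.2 ∩ R'.2) using 1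
  ext i j
  simp only [LinearMap.mulLeft_apply, Pi.mul_apply, Set.inter_indicator_one]
  ring

theorem IsRectangleMixture.pow {K : I → J → ℝ} (hK : IsRectangleMixture K) (T : ℕ) :
    IsRectangleMixture (K ^ T) := by
  induction T with
  | zero => simpa only [pow_zero] using isRectangleMixture_one
  | succ T ih => simpa only [pow_succ] using ih.mul hK

theorem mem_convexHull_range_indicator [Finite I] {a : I → ℝ} (ha : ∀ i, a i ∈ Set.Icc 0 1) :
    a ∈ convexHull ℝ (Set.range fun A : Set I => A.indicator (1 : I → ℝ)) := by
  have h : a ∈ convexHull ℝ (Set.univ.pi fun _ : I => ({0, 1} : Set ℝ)) := by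
    rw [convexHull_pi]
    intro i _
    rw [convexHull_pair, segment_eq_Icc zero_le_one]
    exact ha i
  refine convexHull_mono ?_ h
  refine fun x hx => ⟨{i | x i = 1}, funext fun i => ?_⟩
  rcases hx i trivial with hi | hi <;> simp_all

theorem isRectangleMixture_mul_of_mem_Icc [Finite I] [Finite J] {a : I → ℝ} {b : J → ℝ}
    (ha : ∀ i, a i ∈ Set.Icc 0 1) (hb : ∀ j, b j ∈ Set.Icc 0 1) :
    IsRectangleMixture fun i j => a i * b j := by
  have hrow : IsRectangleMixture fun i (_ : J) => a i := by
    refine isRectangleMixture_map_of_mem_convexHull (LinearMap.pi fun i => LinearMap.pi fun _ =>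
      LinearMap.proj i) (Set.forall_mem_range.2 fun A => ?_) (mem_convexHull_range_indicator ha)
    convert isRectangleMixture_indicator A (Set.univ : Set J) using 1
    ext i j
    simp
  have hcol : IsRectangleMixture fun (_ : I) j => b j := by
    refine isRectangleMixture_map_of_mem_convexHull (LinearMap.pi fun _ => LinearMap.pi fun j =>
      LinearMap.proj j) (Set.forall_mem_range.2 fun B => ?_) (mem_convexHull_range_indicator hb)
    convert isRectangleMixture_indicator (Set.univ : Set I) B using 1
    ext i j
    simp
  exact hrow.mul hcol

theorem isRectangleMixture_one_add_mul_div_four [Finite I] [Finite J] {x : I → ℝ} {y : J → ℝ}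
    (hx : ∀ i, |x i| ≤ 1) (hy : ∀ j, |y j| ≤ 1) :
    IsRectangleMixture fun i j => (1 + x i * y j) / 4 := by
  have hplus : IsRectangleMixture fun i j => (1 + x i) / 2 * ((1 + y j) / 2) :=
    isRectangleMixture_mul_of_mem_Icc
      (fun i => by have := abs_le.1 (hx i); constructor <;> linarith)
      (fun j => by have := abs_le.1 (hy j); constructor <;> linarith)
  have hminus : IsRectangleMixture fun i j => (1 - x i) / 2 * ((1 - y j) / 2) :=
    isRectangleMixture_mul_of_mem_Icc
      (fun i => by have := abs_le.1 (hx i); constructor <;> linarith)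
      (fun j => by have := abs_le.1 (hy j); constructor <;> linarith)
  convert hplus.midpoint hminus using 1
  ext i j
  simp only [midpoint_eq_smul_add, Pi.smul_apply, Pi.add_apply, smul_eq_mul, invOf_eq_inv]
  ring

theorem IsRectangleMixture.exists_sum_le [Fintype I] [Fintype J] {K : I → J → ℝ}
    (hK : IsRectangleMixture K) (w : I → J → ℝ) : ∃ (A : Finset I) (B : Finset J),
      ∑ i, ∑ j, w i j * K i j ≤ ∑ i ∈ A, ∑ j ∈ B, w i j := by
  classical
  let φ : (I → J → ℝ) →ₗ[ℝ] ℝ := ∑ i, ∑ j, w i j •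
    (LinearMap.proj j : (J → ℝ) →ₗ[ℝ] ℝ) ∘ₗ LinearMap.proj i
  have hφ : ∀ L, φ L = ∑ i, ∑ j, w i j * L i j := fun L => by simp [φ]
  obtain ⟨_, ⟨R, rfl⟩, hR⟩ := (φ.convexOn convex_univ).exists_ge_of_mem_convexHull
    (Set.subset_univ _) hK
  refine ⟨R.1.toFinset, R.2.toFinset, ?_⟩
  rw [hφ, hφ] at hR
  refine hR.trans_eq ?_
  simp [Set.indicator_apply, Finset.sum_ite, Set.toFinset, Set.filter_mem_univ_eq_toFinset]

variable {E : Type*} [NormedAddCommGroup E] [InnerProductSpace ℝ E]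

theorem isRectangleMixture_cos_inner_sub [Finite I] [Finite J] (U : I → E) (V : J → E) {α : I → ℝ}
    {β : J → ℝ} (hα : ∀ i, |α i| ≤ 1) (hβ : ∀ j, |β j| ≤ 1) (g : E) :
    IsRectangleMixture fun i j => (1 + 1 / 2 * (α i * β j * Real.cos ⟪g, U i - V j⟫)) / 4 := by
  have hscale : ∀ {s x : ℝ}, |s| ≤ 1 → |x| ≤ 1 → |s * x| ≤ 1 := fun hs hx => by
    simpa only [abs_mul] using mul_le_one₀ hs (abs_nonneg _) hx
  have hcos : IsRectangleMixture fun i j =>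
      (1 + α i * Real.cos ⟪g, U i⟫ * (β j * Real.cos ⟪g, V j⟫)) / 4 :=
    isRectangleMixture_one_add_mul_div_four (fun i => hscale (hα i) (Real.abs_cos_le_one _))
      fun j => hscale (hβ j) (Real.abs_cos_le_one _)
  have hsin : IsRectangleMixture fun i j =>
      (1 + α i * Real.sin ⟪g, U i⟫ * (β j * Real.sin ⟪g, V j⟫)) / 4 :=
    isRectangleMixture_one_add_mul_div_four (fun i => hscale (hα i) (Real.abs_sin_le_one _))
      fun j => hscale (hβ j) (Real.abs_sin_le_one _)
  convert hcos.midpoint hsin using 1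
  ext i j
  simp only [midpoint_eq_smul_add, Pi.smul_apply, Pi.add_apply, smul_eq_mul, invOf_eq_inv,
    inner_sub_right, Real.cos_sub]
  ring

variable [FiniteDimensional ℝ E] [MeasurableSpace E] [BorelSpace E]

theorem integral_cos_inner_stdGaussian (t : E) :
    ∫ g, Real.cos ⟪g, t⟫ ∂(stdGaussian E) = Real.exp (-‖t‖ ^ 2 / 2) := by
  have hint : Integrable (fun g : E => Complex.exp (⟪g, t⟫ * Complex.I)) (stdGaussian E) :=
    Integrable.of_bound (by fun_prop) 1
      (Filter.Eventually.of_forall fun g => (Complex.norm_exp_ofReal_mul_I _).le)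
  have hre := Complex.reCLM.integral_comp_comm hint
  rw [← charFun_apply, charFun_stdGaussian] at hre
  simp only [Complex.reCLM_apply, Complex.exp_ofReal_mul_I_re] at hre
  rw [hre]
  norm_cast

theorem integrable_cos_inner_stdGaussian (t : E) :
    Integrable (fun g => Real.cos ⟪g, t⟫) (stdGaussian E) :=
  Integrable.of_bound (by fun_prop) 1 (Filter.Eventually.of_forall fun g => Real.abs_cos_le_one _)

/-- Random Fourier features: averaging over a Gaussian vector `g` turns the kernels
`cos ⟪g, U i - V j⟫` into the Gaussian kernel `exp (-‖U i - V j‖ ^ 2 / 2)`, and the weights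
`exp (-(1 - ‖U i‖ ^ 2) / 2)` and `exp (-(1 - ‖V j‖ ^ 2) / 2)` turn this into an exponential of the
inner product. -/
theorem isRectangleMixture_exp_inner [Finite I] [Finite J] (U : I → E) (V : J → E)
    (hU : ∀ i, ‖U i‖ ≤ 1) (hV : ∀ j, ‖V j‖ ≤ 1) :
    IsRectangleMixture fun i j => (1 + 1 / 2 * (Real.exp (-1) * Real.exp ⟪U i, V j⟫)) / 4 := by
  have := Fintype.ofFinite I
  have := Fintype.ofFinite J
  let α : E → ℝ := fun x => Real.exp (-(1 - ‖x‖ ^ 2) / 2)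
  have hα : ∀ x, ‖x‖ ≤ 1 → |α x| ≤ 1 := fun x hx => by
    rw [abs_of_pos (Real.exp_pos _), Real.exp_le_one_iff]
    linarith [pow_le_one₀ (n := 2) (norm_nonneg x) hx]
  let K : E → I → J → ℝ := fun g i j =>
    (1 + 1 / 2 * (α (U i) * α (V j) * Real.cos ⟪g, U i - V j⟫)) / 4
  have hentry : ∀ i j, Integrable (fun g => K g i j) (stdGaussian E) := fun i j =>
    ((integrable_const _).add
      (((integrable_cos_inner_stdGaussian _).const_mul _).const_mul _)).div_const _
  have hrow : ∀ i, Integrable (fun g => K g i) (stdGaussian E) := fun i =>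
    Integrable.of_eval (hentry i)
  have hmean : (fun i j => (1 + 1 / 2 * (Real.exp (-1) * Real.exp ⟪U i, V j⟫)) / 4) =
      ∫ g, K g ∂stdGaussian E := by
    ext i j
    have hexp : α (U i) * α (V j) * Real.exp (-‖U i - V j‖ ^ 2 / 2) =
        Real.exp (-1) * Real.exp ⟪U i, V j⟫ := by
      simp only [α, ← Real.exp_add, norm_sub_sq_real]
      ring_nf
    rw [eval_integral fun i => hrow i, eval_integral (hentry i), integral_div, integral_add
      (integrable_const _) (((integrable_cos_inner_stdGaussian _).const_mul _).const_mul _),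
      integral_const_mul, integral_const_mul, integral_cos_inner_stdGaussian, hexp, integral_const,
      probReal_univ, one_smul]
  rw [hmean]
  exact (convex_convexHull ℝ (Set.range _)).integral_mem
    ((Set.finite_range _).isClosed_convexHull ℝ) (Filter.Eventually.of_forall fun g =>
      isRectangleMixture_cos_inner_sub U V (fun i => hα _ (hU i)) (fun j => hα _ (hV j)) g)
    (Integrable.of_eval hrow)

end RectangleMixture

/-! ### Factorization of bounded matrices through an optimal design -/

section OptimalDesign

open Matrix

variable {I J K : Type*}

theorem exists_rank_factorization [Finite I] [Fintype J] (M : Matrix I J ℝ) :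
    ∃ (u : Matrix I (Fin M.rank) ℝ) (v : Matrix (Fin M.rank) J ℝ), M = u * v := by
  let b := Module.finBasisOfFinrankEq ℝ _ M.rank_eq_finrank_span_row.symm
  refine ⟨Matrix.of fun i => b.repr ⟨M i, Submodule.subset_span ⟨i, rfl⟩⟩,
    Matrix.of fun k => (b k).1, ?_⟩
  ext i j
  have hrow := congrArg Subtype.val (b.sum_repr ⟨M i, Submodule.subset_span ⟨i, rfl⟩⟩)
  simpa [-Module.Basis.sum_repr, Matrix.mul_apply] using (congrFun hrow j).symm

variable [Fintype I]

theorem det_transpose_mul_self_pos [Fintype K] [DecidableEq K] {u : Matrix I K ℝ}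
    (hu : u.rank = Fintype.card K) : 0 < (uᵀ * u).det := by
  have hcol : LinearIndependent ℝ u.col := by
    rw [linearIndependent_iff_card_eq_finrank_span, Set.finrank, ← rank_eq_finrank_span_cols, hu]
  simpa only [conjTranspose_eq_transpose_of_trivial] using
    (PosDef.conjTranspose_mul_self u (mulVec_injective_iff.2 hcol)).det_pos

/-- The matrix of second moments of the rows of `u`, weighted by `p`. -/
def momentMatrix (u : Matrix I K ℝ) (p : I → ℝ) : Matrix K K ℝ :=
  ∑ i, p i • vecMulVec (u i) (u i)

theorem isSymm_momentMatrix (u : Matrix I K ℝ) (p : I → ℝ) : (momentMatrix u p).IsSymm := by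
  simp only [IsSymm, momentMatrix, transpose_sum, transpose_smul, transpose_vecMulVec]

theorem momentMatrix_smul (u : Matrix I K ℝ) (c : ℝ) (p : I → ℝ) :
    momentMatrix u (c • p) = c • momentMatrix u p := by
  simp only [momentMatrix, Pi.smul_apply, smul_assoc, Finset.smul_sum]

theorem momentMatrix_one (u : Matrix I K ℝ) : momentMatrix u 1 = uᵀ * u := by
  ext a b
  simp [momentMatrix, Matrix.sum_apply, vecMulVec_apply, Matrix.mul_apply]

variable [Fintype K]

theorem momentMatrix_mulVec (u : Matrix I K ℝ) (p : I → ℝ) (z : K → ℝ) :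
    momentMatrix u p *ᵥ z = ∑ i, (p i * (u i ⬝ᵥ z)) • u i := by
  simp only [momentMatrix, sum_mulVec, smul_mulVec, vecMulVec_mulVec, op_smul_eq_smul, mul_smul]

theorem det_momentMatrix_add_single [DecidableEq I] [DecidableEq K] {u : Matrix I K ℝ} {p : I → ℝ}
    (hp : IsUnit (momentMatrix u p).det) (i : I) (s : ℝ) :
    (momentMatrix u (p + Pi.single i s)).det =
      (momentMatrix u p).det * (1 + s * (u i ⬝ᵥ (momentMatrix u p)⁻¹ *ᵥ u i)) := by
  have hadd : momentMatrix u (p + Pi.single i s) =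
      momentMatrix u p + replicateCol Unit (s • u i) * replicateRow Unit (u i) := by
    rw [← vecMulVec_eq, smul_vecMulVec]
    simp [momentMatrix, add_smul, Finset.sum_add_distrib, Pi.single_apply, ite_smul]
  rw [hadd, det_add_replicateCol_mul_replicateRow hp, Matrix.mul_assoc, ← replicateCol_mulVec,
    det_unique (1 + _), Matrix.add_apply, Matrix.one_apply_eq, replicateRow_mul_replicateCol_apply,
    mulVec_smul, dotProduct_smul, smul_eq_mul]

theorem le_of_forall_one_add_mul_le_pow {q : ℝ} {r : ℕ}
    (h : ∀ s : ℝ, 0 < s → 1 + s * q ≤ (1 + s) ^ r) : q ≤ r := by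
  have hderiv : HasDerivAt (fun s : ℝ => (1 + s) ^ r) (r * (1 + 0) ^ (r - 1) * 1) 0 :=
    ((hasDerivAt_id (0 : ℝ)).const_add 1).pow r
  refine ge_of_tendsto (by simpa using hderiv.tendsto_slope_zero_right) ?_
  filter_upwards [self_mem_nhdsWithin] with s hs
  rw [le_inv_mul_iff₀ hs]
  linarith [h s hs]

/-- The weighting maximizing the determinant of the moment matrix works, by perturbing it towards a
single row. -/
theorem exists_optimal_design [Nonempty I] [DecidableEq K] {u : Matrix I K ℝ}
    (hu : u.rank = Fintype.card K) :
    ∃ p ∈ stdSimplex ℝ I, IsUnit (momentMatrix u p).det ∧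
      ∀ i, u i ⬝ᵥ (momentMatrix u p)⁻¹ *ᵥ u i ≤ Fintype.card K := by
  classical
  have hcont : Continuous fun p : I → ℝ => (momentMatrix u p).det := by
    unfold momentMatrix
    fun_prop
  have huniform : (Fintype.card I : ℝ)⁻¹ • (1 : I → ℝ) ∈ stdSimplex ℝ I :=
    ⟨fun _ => by simp, by simp⟩
  obtain ⟨p, hp, hmax⟩ := (isCompact_stdSimplex ℝ I).exists_isMaxOn ⟨_, huniform⟩ hcont.continuousOn
  have hdet : 0 < (momentMatrix u p).det := by
    refine lt_of_lt_of_le ?_ (hmax huniform)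
    simp only [momentMatrix_smul, momentMatrix_one, det_smul]
    have := det_transpose_mul_self_pos hu
    positivity
  refine ⟨p, hp, hdet.ne'.isUnit, fun i => le_of_forall_one_add_mul_le_pow fun s hs => ?_⟩
  have hperturb : (1 + s)⁻¹ • (p + Pi.single i s) ∈ stdSimplex ℝ I := by
    refine ⟨fun k => ?_, ?_⟩
    · have hsingle : (0 : I → ℝ) ≤ Pi.single i s := Pi.single_nonneg.2 hs.le
      exact mul_nonneg (inv_nonneg.2 (add_pos one_pos hs).le) (add_nonneg (hp.1 k) (hsingle k))
    · simp only [Pi.smul_apply, Pi.add_apply, smul_eq_mul, ← Finset.mul_sum,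
        Finset.sum_add_distrib, hp.2, Finset.sum_pi_single', Finset.mem_univ, if_true]
      exact inv_mul_cancel₀ (add_pos one_pos hs).ne'
  have hle := hmax hperturb
  simp only [Set.mem_ofPred_eq, momentMatrix_smul, det_smul,
    det_momentMatrix_add_single hdet.ne'.isUnit] at hle
  rwa [inv_pow, inv_mul_le_iff₀ (by positivity), mul_comm, mul_le_mul_iff_left₀ hdet] at hle

theorem sum_mul_dotProduct_momentMatrix_inv_mulVec [DecidableEq K] {u : Matrix I K ℝ} {p : I → ℝ}
    (hp : IsUnit (momentMatrix u p).det) (x z : K → ℝ) :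
    ∑ k, p k * (x ⬝ᵥ (momentMatrix u p)⁻¹ *ᵥ u k) * (u k ⬝ᵥ z) = x ⬝ᵥ z := by
  have hz : (momentMatrix u p)⁻¹ *ᵥ (momentMatrix u p *ᵥ z) = z := by
    rw [mulVec_mulVec, nonsing_inv_mul _ hp, one_mulVec]
  conv_rhs => rw [← hz, momentMatrix_mulVec, mulVec_sum, dotProduct_sum]
  refine Finset.sum_congr rfl fun k _ => ?_
  rw [mulVec_smul, dotProduct_smul, smul_eq_mul]
  ring

theorem sum_mul_sq_dotProduct_momentMatrix_inv_mulVec [DecidableEq K] {u : Matrix I K ℝ}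
    {p : I → ℝ} (hp : IsUnit (momentMatrix u p).det) (x : K → ℝ) :
    ∑ k, p k * (x ⬝ᵥ (momentMatrix u p)⁻¹ *ᵥ u k) ^ 2 = x ⬝ᵥ (momentMatrix u p)⁻¹ *ᵥ x := by
  have hsymm : ∀ k, u k ⬝ᵥ (momentMatrix u p)⁻¹ *ᵥ x = x ⬝ᵥ (momentMatrix u p)⁻¹ *ᵥ u k :=
    fun k => by rw [dotProduct_mulVec, ← mulVec_transpose, transpose_nonsing_inv,
      (isSymm_momentMatrix u p).eq, dotProduct_comm]
  rw [← sum_mul_dotProduct_momentMatrix_inv_mulVec hp x]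
  simp only [hsymm, sq, mul_assoc]

theorem inner_toLp_sqrt_mul {p : I → ℝ} (hp : ∀ k, 0 ≤ p k) (f g : I → ℝ) :
    inner ℝ (WithLp.toLp 2 fun k => √(p k) * f k) (WithLp.toLp 2 fun k => √(p k) * g k) =
      ∑ k, p k * f k * g k := by
  rw [PiLp.inner_apply]
  refine Finset.sum_congr rfl fun k _ => ?_
  rw [RCLike.inner_apply, conj_trivial]
  linear_combination f k * g k * Real.mul_self_sqrt (hp k)

theorem norm_toLp_sqrt_mul_sq {p : I → ℝ} (hp : ∀ k, 0 ≤ p k) (f : I → ℝ) :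
    ‖WithLp.toLp 2 fun k => √(p k) * f k‖ ^ 2 = ∑ k, p k * f k ^ 2 := by
  rw [← real_inner_self_eq_norm_sq, inner_toLp_sqrt_mul hp]
  simp only [sq, mul_assoc]

theorem exists_bounded_factorization [Nonempty I] [Fintype J] {M : Matrix I J ℝ} {D : ℝ}
    (hM : ∀ i j, |M i j| ≤ D) :
    ∃ (x : I → EuclideanSpace ℝ I) (y : J → EuclideanSpace ℝ I),
      (∀ i j, inner ℝ (x i) (y j) = M i j) ∧ (∀ i, ‖x i‖ ≤ √M.rank) ∧ ∀ j, ‖y j‖ ≤ D := by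
  obtain ⟨u, v, huv⟩ := exists_rank_factorization M
  have hu : u.rank = Fintype.card (Fin M.rank) := by
    refine le_antisymm u.rank_le_card_width ?_
    conv_lhs => rw [Fintype.card_fin, huv]
    exact rank_mul_le_left u v
  obtain ⟨p, ⟨hp₀, hp₁⟩, hdet, hlev⟩ := exists_optimal_design hu
  rw [Fintype.card_fin] at hlev
  have hM_eq : ∀ i j, M i j = u i ⬝ᵥ vᵀ j := fun i j => congrFun (congrFun huv i) j
  refine ⟨fun i => WithLp.toLp 2 fun k => √(p k) * (u i ⬝ᵥ (momentMatrix u p)⁻¹ *ᵥ u k),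
    fun j => WithLp.toLp 2 fun k => √(p k) * M k j, fun i j => ?_, fun i => ?_, fun j => ?_⟩
  · rw [inner_toLp_sqrt_mul hp₀, hM_eq i j, ← sum_mul_dotProduct_momentMatrix_inv_mulVec hdet]
    simp only [hM_eq]
  · rw [Real.le_sqrt (norm_nonneg _) (Nat.cast_nonneg _), norm_toLp_sqrt_mul_sq hp₀,
      sum_mul_sq_dotProduct_momentMatrix_inv_mulVec hdet]
    exact hlev i
  · have hD : 0 ≤ D := (abs_nonneg _).trans (hM (Classical.arbitrary I) j)
    rw [← sq_le_sq₀ (norm_nonneg _) hD, norm_toLp_sqrt_mul_sq hp₀]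
    calc ∑ k, p k * M k j ^ 2 ≤ ∑ k, p k * D ^ 2 := by
          refine Finset.sum_le_sum fun k _ => mul_le_mul_of_nonneg_left ?_ (hp₀ k)
          exact sq_le_sq.2 ((hM k j).trans (le_abs_self D))
      _ = D ^ 2 := by rw [← Finset.sum_mul, hp₁, one_mul]

end OptimalDesign

/-! ### Large monochromatic rectangles -/

section DominantValue

variable {Δ T₀ : ℕ} {μ κ : ℕ → ℝ} {η : ℝ}

theorem exists_succ_eq_of_monotone {v : ℕ → ℕ} (hv : Monotone v) (hΔ : ∀ k, v k ≤ Δ) :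
    ∃ k ≤ Δ, v (k + 1) = v k := by
  by_contra! hne
  have hlt : ∀ k ≤ Δ, v k < v (k + 1) := fun k hk => (hv k.le_succ).lt_of_ne (hne k hk).symm
  have hge : ∀ k ≤ Δ + 1, k ≤ v k := fun k hk => by
    induction k with
    | zero => exact Nat.zero_le _
    | succ k ih => exact (ih (by lia)).trans_lt (hlt k (by lia))
  exact absurd (hge (Δ + 1) le_rfl) (by simpa using (hΔ (Δ + 1)))

theorem le_of_isMaxOn_mul_pow {s : Set ℕ} (hκ : ∀ w, 0 < κ w) (hκmono : StrictMono κ) {u v m t : ℕ}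
    (hus : u ∈ s) (hvs : v ∈ s) (hμ : 0 < μ u) (ht : t ≠ 0)
    (hu : IsMaxOn (fun w => μ w * κ w ^ m) s u)
    (hv : IsMaxOn (fun w => μ w * κ w ^ (m + t)) s v) : u ≤ v := by
  by_contra! hvu
  refine lt_irrefl (μ v * κ v ^ (m + t)) ?_
  calc μ v * κ v ^ (m + t) = μ v * κ v ^ m * κ v ^ t := by ring
    _ ≤ μ u * κ u ^ m * κ v ^ t := mul_le_mul_of_nonneg_right (hu hvs) (pow_pos (hκ v) t).le
    _ < μ u * κ u ^ m * κ u ^ t := mul_lt_mul_of_pos_left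
      (pow_lt_pow_left₀ (hκmono hvu) (hκ v).le ht) (mul_pos hμ (pow_pos (hκ u) m))
    _ = μ u * κ u ^ (m + t) := by ring
    _ ≤ μ v * κ v ^ (m + t) := hv hus

theorem pow_mul_le_of_isMaxOn_of_isMaxOn {s : Set ℕ} (hη : 0 ≤ η) (hμ : ∀ w, 0 ≤ μ w)
    (hκ : ∀ w, 0 < κ w) (hgap : ∀ u w, u < w → η * κ u ≤ κ w) {v m t : ℕ}
    (hv : IsMaxOn (fun w => μ w * κ w ^ m) s v)
    (hv' : IsMaxOn (fun w => μ w * κ w ^ (m + 2 * t)) s v) {w : ℕ} (hw : w ∈ s) (hne : w ≠ v) :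
    η ^ t * (μ w * κ w ^ (m + t)) ≤ μ v * κ v ^ (m + t) := by
  have hpow : ∀ {a b}, a < b → (η * κ a) ^ t ≤ κ b ^ t := fun {a b} hab =>
    pow_le_pow_left₀ (mul_nonneg hη (hκ a).le) (hgap a b hab) t
  have hnn : ∀ a k, 0 ≤ μ a * κ a ^ k := fun a k => mul_nonneg (hμ a) (pow_pos (hκ a) k).le
  rcases hne.lt_or_gt with hlt | hgt
  · calc η ^ t * (μ w * κ w ^ (m + t)) = μ w * κ w ^ m * (η * κ w) ^ t := by ring
      _ ≤ μ v * κ v ^ m * κ v ^ t :=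
        mul_le_mul (hv hw) (hpow hlt) (pow_nonneg (mul_nonneg hη (hκ w).le) t) (hnn v m)
      _ = μ v * κ v ^ (m + t) := by ring
  · refine le_of_mul_le_mul_right ?_ (pow_pos (hκ v) t)
    calc η ^ t * (μ w * κ w ^ (m + t)) * κ v ^ t = μ w * κ w ^ (m + t) * (η * κ v) ^ t := by ring
      _ ≤ μ w * κ w ^ (m + t) * κ w ^ t := mul_le_mul_of_nonneg_left (hpow hgt) (hnn w _)
      _ = μ w * κ w ^ (m + 2 * t) := by ring
      _ ≤ μ v * κ v ^ (m + 2 * t) := hv' hw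
      _ = μ v * κ v ^ (m + t) * κ v ^ t := by ring

/-- The maximizer of `μ w * κ w ^ T` over `w ≤ Δ` is monotone in `T`, so it is the same for two
consecutive even multiples of `T₀`; halfway between them it wins by the factor `η ^ T₀`. -/
theorem exists_dominant_value (hT₀ : T₀ ≠ 0) (hη : 1 < η) (hμ : ∀ w, 0 ≤ μ w)
    (hμpos : ∃ w ≤ Δ, 0 < μ w) (hκ : ∀ w, 0 < κ w) (hgap : ∀ u w, u < w → η * κ u ≤ κ w) :
    ∃ T ≤ (2 * Δ + 1) * T₀, ∃ v ≤ Δ,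
      ∀ w ≤ Δ, w ≠ v → η ^ T₀ * (μ w * κ w ^ T) ≤ μ v * κ v ^ T := by
  have hκmono : StrictMono κ := fun u w h =>
    (lt_mul_of_one_lt_left (hκ u) hη).trans_le (hgap u w h)
  have hmax : ∀ k, ∃ v ∈ Set.Iic Δ, IsMaxOn (fun w => μ w * κ w ^ (k * (2 * T₀))) (Set.Iic Δ) v :=
    fun k => Set.exists_max_image (Set.Iic Δ) (fun w => μ w * κ w ^ (k * (2 * T₀)))
      (Set.finite_Iic Δ) Set.nonempty_Iic
  choose v hvΔ hv using hmax
  have hμv : ∀ k, 0 < μ (v k) := fun k => by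
    obtain ⟨w, hw, hw0⟩ := hμpos
    exact pos_of_mul_pos_left ((mul_pos hw0 (pow_pos (hκ w) _)).trans_le (hv k hw))
      (pow_pos (hκ _) _).le
  have hnext : ∀ k,
      IsMaxOn (fun w => μ w * κ w ^ (k * (2 * T₀) + 2 * T₀)) (Set.Iic Δ) (v (k + 1)) :=
    fun k => by simpa only [add_mul, one_mul] using hv (k + 1)
  have hmono : Monotone v := monotone_nat_of_le_succ fun k =>
    le_of_isMaxOn_mul_pow hκ hκmono (hvΔ k) (hvΔ (k + 1)) (hμv k) (by lia) (hv k) (hnext k)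
  obtain ⟨k, hkΔ, hk⟩ := exists_succ_eq_of_monotone hmono hvΔ
  refine ⟨k * (2 * T₀) + T₀, by nlinarith, v k, hvΔ k, fun w hw hne => ?_⟩
  exact pow_mul_le_of_isMaxOn_of_isMaxOn (by linarith) hμ hκ hgap (hv k) (hk ▸ hnext k) hw hne

theorem half_le_sum_ite_mul_of_dominant {v : ℕ} {f : ℕ → ℝ} {K : ℝ} (hΔ : 0 < Δ) (hv : v ≤ Δ)
    (hf : ∀ w ≤ Δ, w ≠ v → 2 * K * Δ * f w ≤ f v) :
    f v / 2 ≤ ∑ w ∈ Finset.Iic Δ, (if w = v then 1 else -K) * f w := by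
  have hvΔ : v ∈ Finset.Iic Δ := Finset.mem_Iic.2 hv
  rw [← Finset.add_sum_erase _ _ hvΔ, if_pos rfl, one_mul]
  have hterm : ∀ w ∈ (Finset.Iic Δ).erase v,
      -(f v / (2 * Δ)) ≤ (if w = v then 1 else -K) * f w := fun w hw => by
    obtain ⟨hwv, hwΔ⟩ := Finset.mem_erase.1 hw
    rw [if_neg hwv, neg_mul, neg_le_neg_iff, le_div_iff₀ (by positivity)]
    linarith [hf w (Finset.mem_Iic.1 hwΔ) hwv]
  have hsum := Finset.card_nsmul_le_sum _ _ _ hterm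
  rw [Finset.card_erase_of_mem hvΔ, Nat.card_Iic, Nat.add_sub_cancel, nsmul_eq_mul] at hsum
  have hcancel : (Δ : ℝ) * -(f v / (2 * Δ)) = -(f v / 2) := by field_simp
  linarith

end DominantValue

/-- The function applied entrywise to a low rank matrix to turn it into a mixture of rectangles,
where `ε` is the reciprocal of the product of the norms of the factors. -/
noncomputable def roundingKernel (ε : ℝ) (w : ℕ) : ℝ :=
  (1 + 1 / 2 * (Real.exp (-1) * Real.exp (ε * w))) / 4

theorem quarter_le_roundingKernel (ε : ℝ) (w : ℕ) : 1 / 4 ≤ roundingKernel ε w := by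
  have : 0 < 1 / 2 * (Real.exp (-1) * Real.exp (ε * w)) := by positivity
  rw [roundingKernel]
  linarith

theorem one_add_div_seven_mul_roundingKernel_le {ε : ℝ} (hε : 0 ≤ ε) {u w : ℕ} (huw : u < w) :
    (1 + ε / 7) * roundingKernel ε u ≤ roundingKernel ε w := by
  have hstep : Real.exp (ε * u) * (1 + ε) ≤ Real.exp (ε * w) := by
    have huw' : (u : ℝ) + 1 ≤ w := by exact_mod_cast huw
    calc Real.exp (ε * u) * (1 + ε) ≤ Real.exp (ε * u) * Real.exp ε := by
          gcongr
          linarith [Real.add_one_le_exp ε]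
      _ = Real.exp (ε * (u + 1)) := by rw [← Real.exp_add, mul_add_one]
      _ ≤ Real.exp (ε * w) := by gcongr
  have hthird : 1 / 3 ≤ Real.exp (-1) * Real.exp (ε * u) := by
    have hexp : 1 / 3 ≤ Real.exp (-1) := by
      rw [Real.exp_neg, one_div]
      exact inv_anti₀ (Real.exp_pos 1) (by linarith [Real.exp_one_lt_d9])
    exact hexp.trans (le_mul_of_one_le_right (Real.exp_pos _).le (Real.one_le_exp (by positivity)))
  have hstep' := mul_le_mul_of_nonneg_left hstep (Real.exp_pos (-1)).le
  have hε' := mul_le_mul_of_nonneg_left hthird hε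
  simp only [roundingKernel]
  linarith

section Rows

variable {F I J : Type*}

theorem exists_spanning_rows [Field F] [Finite I] [Fintype J] (M : Matrix I J F) (s : Finset I) :
    ∃ t ⊆ s, t.card ≤ M.rank ∧ ∀ i ∈ s, M.row i ∈ Submodule.span F (M.row '' t) := by
  obtain ⟨b, hbs, -, hspan, hb⟩ := exists_linearIndepOn_extension
    (linearIndepOn_empty F M.row) (Set.empty_subset (s : Set I))
  lift b to Finset I using s.finite_toSet.subset hbs
  refine ⟨b, Finset.coe_subset.1 hbs, ?_, fun i hi => hspan ⟨i, hi, rfl⟩⟩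
  calc b.card = Module.finrank F (Submodule.span F (M.row '' b)) := by
        rw [Set.image_eq_range, finrank_span_eq_card hb]
        exact (Fintype.card_coe b).symm
    _ ≤ M.rank := by
        rw [M.rank_eq_finrank_span_row]
        exact Submodule.finrank_mono (Submodule.span_mono (Set.image_subset_range _ _))

theorem eq_of_mem_span_rows [Semiring F] {M : Matrix I J F} {t : Set I} {j j' : J}
    (h : ∀ i ∈ t, M i j = M i j') {f : J → F} (hf : f ∈ Submodule.span F (M.row '' t)) :
    f j = f j' := by
  have hle : Submodule.span F (M.row '' t) ≤
      LinearMap.eqLocus (LinearMap.proj j : (J → F) →ₗ[F] F) (LinearMap.proj j') :=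
    Submodule.span_le.2 (Set.forall_mem_image.2 h)
  exact hle hf

end Rows

/-- The matrices of rank at most `r` with entries in `{0, …, Δ}`. -/
structure IsBoundedOfRankLE {I J : Type*} [Fintype J] (Δ r : ℕ) (A : Matrix I J ℕ) : Prop where
  le : ∀ i j, A i j ≤ Δ
  rank_le : (A.map (Nat.cast : ℕ → ℝ)).rank ≤ r

section Rectangles

open RealInnerProductSpace

variable {I J : Type*}

theorem isRectangleMixture_roundingKernel [Finite I] [Nonempty I] [Fintype J] {Δ r : ℕ}
    (hΔ : 0 < Δ) (hr : 0 < r) {A : Matrix I J ℕ} (hA : IsBoundedOfRankLE Δ r A) :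
    IsRectangleMixture fun i j => roundingKernel (1 / (Δ * √r)) (A i j) := by
  have := Fintype.ofFinite I
  have hΔ' : (0 : ℝ) < Δ := by exact_mod_cast hΔ
  have hr' : 0 < √(r : ℝ) := Real.sqrt_pos.2 (by exact_mod_cast hr)
  obtain ⟨x, y, hxy, hx, hy⟩ := exists_bounded_factorization
    (M := A.map (Nat.cast : ℕ → ℝ)) (D := Δ) fun i j => by simpa using hA.le i j
  have hmix := isRectangleMixture_exp_inner (fun i => (√r)⁻¹ • x i) (fun j => (Δ : ℝ)⁻¹ • y j)
    (fun i => by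
      rw [norm_smul, norm_inv, Real.norm_of_nonneg hr'.le, inv_mul_le_one₀ hr']
      exact (hx i).trans (Real.sqrt_le_sqrt (by exact_mod_cast hA.rank_le)))
    (fun j => by
      rw [norm_smul, norm_inv, Real.norm_of_nonneg hΔ'.le, inv_mul_le_one₀ hΔ']
      exact hy j)
  have hinner : ∀ i j, ⟪(√r)⁻¹ • x i, (Δ : ℝ)⁻¹ • y j⟫ = 1 / (Δ * √r) * A i j := fun i j => by
    rw [real_inner_smul_left, real_inner_smul_right, hxy, Matrix.map_apply]
    field_simp
  simpa only [hinner, roundingKernel] using hmix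

theorem sum_comp_eq_sum_card_mul [Fintype I] [Fintype J] {Δ : ℕ} {A : Matrix I J ℕ}
    (hA : ∀ i j, A i j ≤ Δ) (φ : ℕ → ℝ) :
    ∑ i, ∑ j, φ (A i j) =
      ∑ w ∈ Finset.Iic Δ, ((Finset.univ.filter fun p : I × J => A p.1 p.2 = w).card : ℝ) * φ w := by
  rw [← Fintype.sum_prod_type' fun i j => φ (A i j), ← Finset.sum_fiberwise_of_maps_to
    (t := Finset.Iic Δ) (g := fun p : I × J => A p.1 p.2) fun p _ => Finset.mem_Iic.2 (hA p.1 p.2)]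
  refine Finset.sum_congr rfl fun w _ => ?_
  rw [Finset.sum_congr rfl fun p hp => congrArg φ (Finset.mem_filter.1 hp).2, Finset.sum_const,
    nsmul_eq_mul]

theorem sum_sum_ite_eq_sub (A : Matrix I J ℕ) (R : Finset I) (C : Finset J) (v : ℕ) (K : ℝ) :
    ∑ i ∈ R, ∑ j ∈ C, (if A i j = v then 1 else -K) =
      R.card * C.card - (K + 1) * ((∑ i ∈ R, (C.filter fun j => A i j ≠ v).card : ℕ) : ℝ) := by
  have hrow : ∀ i, ∑ j ∈ C, (if A i j = v then 1 else -K) =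
      C.card - (K + 1) * ((C.filter fun j => A i j ≠ v).card : ℝ) := fun i => by
    have hcard : ((C.filter fun j => A i j = v).card : ℝ) +
        (C.filter fun j => A i j ≠ v).card = C.card := by
      exact_mod_cast Finset.card_filter_add_card_filter_not (s := C) fun j => A i j = v
    rw [Finset.sum_ite, Finset.sum_const, Finset.sum_const, nsmul_eq_mul, nsmul_eq_mul, ← hcard]
    ring
  simp only [hrow, Finset.sum_sub_distrib, Finset.sum_const, nsmul_eq_mul, ← Finset.mul_sum,
    Nat.cast_sum]

theorem card_mul_card_le_of_forall_card_mul_pow_le [Fintype I] [Fintype J] {Δ : ℕ}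
    {A : Matrix I J ℕ} (hA : ∀ i j, A i j ≤ Δ) {κ : ℕ → ℝ} (hκ : ∀ w, 1 / 4 ≤ κ w) {T : ℕ} {c : ℝ}
    (hc : ∀ w ≤ Δ,
      ((Finset.univ.filter fun p : I × J => A p.1 p.2 = w).card : ℝ) * κ w ^ T ≤ c) :
    (Fintype.card I * Fintype.card J : ℝ) ≤ (Δ + 1) * 4 ^ T * c := by
  have hsum : (1 / 4 : ℝ) ^ T * (Fintype.card I * Fintype.card J) ≤ (Δ + 1) * c := calc
    (1 / 4 : ℝ) ^ T * (Fintype.card I * Fintype.card J)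
      = ∑ _i : I, ∑ _j : J, (1 / 4 : ℝ) ^ T := by
        simp only [Finset.sum_const, Finset.card_univ, nsmul_eq_mul]
        ring
    _ ≤ ∑ i, ∑ j, κ (A i j) ^ T := by
        gcongr
        exact hκ _
    _ = ∑ w ∈ Finset.Iic Δ,
          ((Finset.univ.filter fun p : I × J => A p.1 p.2 = w).card : ℝ) * κ w ^ T :=
        sum_comp_eq_sum_card_mul hA fun w => κ w ^ T
    _ ≤ (Finset.Iic Δ).card • c := Finset.sum_le_card_nsmul _ _ _ fun w hw =>
        hc w (Finset.mem_Iic.1 hw)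
    _ = (Δ + 1) * c := by rw [Nat.card_Iic, nsmul_eq_mul, Nat.cast_add_one]
  rw [one_div, inv_pow, inv_mul_le_iff₀ (by positivity)] at hsum
  linarith

theorem exists_sum_sum_ite_large [Fintype I] [Fintype J] [Nonempty I] [Nonempty J]
    {Δ r T₀ : ℕ} {K : ℝ} (hΔ : 0 < Δ) (hr : 0 < r) (hT₀ : T₀ ≠ 0) {A : Matrix I J ℕ}
    (hA : IsBoundedOfRankLE Δ r A)
    (hK : 2 * K * Δ ≤ (1 + 1 / (Δ * √r) / 7) ^ T₀) :
    ∃ (R : Finset I) (C : Finset J) (v : ℕ), (Fintype.card I * Fintype.card J : ℝ) ≤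
      2 * (Δ + 1) * 4 ^ ((2 * Δ + 1) * T₀) *
        ∑ i ∈ R, ∑ j ∈ C, if A i j = v then 1 else -K := by
  set ε : ℝ := 1 / (Δ * √r)
  have hε : 0 < ε := by positivity
  let μ : ℕ → ℝ := fun w => ((Finset.univ.filter fun p : I × J => A p.1 p.2 = w).card : ℝ)
  have hμpos : ∃ w ≤ Δ, 0 < μ w := by
    inhabit I
    inhabit J
    exact ⟨_, hA.le default default,
      Nat.cast_pos.2 (Finset.card_pos.2 ⟨(default, default), by simp⟩)⟩
  have hκ : ∀ w, 0 < roundingKernel ε w := fun w =>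
    lt_of_lt_of_le (by norm_num) (quarter_le_roundingKernel ε w)
  obtain ⟨T, hT, v, hvΔ, hdom⟩ := exists_dominant_value hT₀ (η := 1 + ε / 7) (by linarith)
    (fun _ => Nat.cast_nonneg _) hμpos hκ fun u w => one_add_div_seven_mul_roundingKernel_le hε.le
  let f : ℕ → ℝ := fun w => μ w * roundingKernel ε w ^ T
  have hf : ∀ w, 0 ≤ f w := fun w => mul_nonneg (Nat.cast_nonneg _) (pow_pos (hκ w) T).le
  have hfv : ∀ w ≤ Δ, f w ≤ f v := fun w hw => by
    obtain rfl | hne := eq_or_ne w v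
    · exact le_rfl
    · exact (le_mul_of_one_le_left (hf w) (one_le_pow₀ (by linarith))).trans (hdom w hw hne)
  obtain ⟨R, C, hRC⟩ := ((isRectangleMixture_roundingKernel hΔ hr hA).pow T).exists_sum_le
    fun i j => if A i j = v then 1 else -K
  have hlower : f v / 2 ≤ ∑ i ∈ R, ∑ j ∈ C, if A i j = v then 1 else -K := calc
    f v / 2 ≤ ∑ w ∈ Finset.Iic Δ, (if w = v then 1 else -K) * f w :=
      half_le_sum_ite_mul_of_dominant hΔ hvΔ fun w hw hne =>
        (mul_le_mul_of_nonneg_right hK (hf w)).trans (hdom w hw hne)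
    _ = ∑ i, ∑ j, (if A i j = v then 1 else -K) * roundingKernel ε (A i j) ^ T := by
      rw [sum_comp_eq_sum_card_mul hA.le
        fun w => (if w = v then 1 else -K) * roundingKernel ε w ^ T]
      exact Finset.sum_congr rfl fun w _ => mul_left_comm _ _ _
    _ ≤ ∑ i ∈ R, ∑ j ∈ C, if A i j = v then 1 else -K := hRC
  refine ⟨R, C, v, ?_⟩
  calc (Fintype.card I * Fintype.card J : ℝ) ≤ (Δ + 1) * 4 ^ T * f v :=
      card_mul_card_le_of_forall_card_mul_pow_le hA.le (quarter_le_roundingKernel ε) hfv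
    _ ≤ (Δ + 1) * 4 ^ ((2 * Δ + 1) * T₀) * f v := by
      gcongr
      exacts [hf v, by norm_num]
    _ = 2 * (Δ + 1) * 4 ^ ((2 * Δ + 1) * T₀) * (f v / 2) := by ring
    _ ≤ _ := by gcongr

theorem exists_almost_monochromatic [Fintype I] [Fintype J] [Nonempty I] [Nonempty J]
    {Δ r T₀ K : ℕ} (hΔ : 0 < Δ) (hr : 0 < r) (hT₀ : T₀ ≠ 0) {A : Matrix I J ℕ}
    (hA : IsBoundedOfRankLE Δ r A)
    (hK : (2 * K * Δ : ℝ) ≤ (1 + 1 / (Δ * √r) / 7) ^ T₀) :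
    ∃ (R : Finset I) (C : Finset J) (v : ℕ),
      K * ∑ i ∈ R, (C.filter fun j => A i j ≠ v).card < R.card * C.card ∧
      Fintype.card I * Fintype.card J ≤
        2 * (Δ + 1) * 4 ^ ((2 * Δ + 1) * T₀) * (R.card * C.card) := by
  obtain ⟨R, C, v, h⟩ := exists_sum_sum_ite_large hΔ hr hT₀ hA hK
  have hcard : (0 : ℝ) < Fintype.card I * Fintype.card J := by
    exact_mod_cast Nat.mul_pos Fintype.card_pos Fintype.card_pos
  have hsum := pos_of_mul_pos_right (hcard.trans_le h) (by positivity)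
  rw [sum_sum_ite_eq_sub] at h hsum
  have hbad : (0 : ℝ) ≤ ((∑ i ∈ R, (C.filter fun j => A i j ≠ v).card : ℕ) : ℝ) :=
    Nat.cast_nonneg _
  refine ⟨R, C, v, ?_, ?_⟩
  · exact_mod_cast (by linarith : (K : ℝ) *
      ((∑ i ∈ R, (C.filter fun j => A i j ≠ v).card : ℕ) : ℝ) < R.card * C.card)
  · have hle := h.trans (mul_le_mul_of_nonneg_left
      (sub_le_self _ (mul_nonneg (by positivity) hbad)) (by positivity))
    exact_mod_cast hle

theorem card_le_two_mul_card_filter {s : Finset I} {b : I → ℕ} {c n : ℕ} (hn : 0 < n)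
    (h : 2 * c * ∑ i ∈ s, b i ≤ s.card * n) :
    s.card ≤ 2 * (s.filter fun i => c * b i ≤ n).card := by
  have hsplit := Finset.card_filter_add_card_filter_not (s := s) fun i => c * b i ≤ n
  have hmarkov : (s.filter fun i => ¬ c * b i ≤ n).card * n ≤ c * ∑ i ∈ s, b i := calc
    _ ≤ ∑ i ∈ s.filter fun i => ¬ c * b i ≤ n, c * b i :=
      Finset.card_nsmul_le_sum _ _ _ fun i hi => (not_le.1 (Finset.mem_filter.1 hi).2).le
    _ ≤ ∑ i ∈ s, c * b i := Finset.sum_le_sum_of_subset (Finset.filter_subset _ _)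
    _ = c * ∑ i ∈ s, b i := (Finset.mul_sum _ _ _).symm
  have : 2 * (s.filter fun i => ¬ c * b i ≤ n).card ≤ s.card :=
    Nat.le_of_mul_le_mul_right (by linarith) hn
  lia

theorem card_le_two_mul_card_filter_forall_eq {t : Finset I} {C : Finset J} {α : Type*}
    [DecidableEq α] {f : I → J → α} {a : α} {r : ℕ} (hr : 0 < r) (ht : t.card ≤ r)
    (h : ∀ i ∈ t, 2 * r * (C.filter fun j => f i j ≠ a).card ≤ C.card) :
    C.card ≤ 2 * (C.filter fun j => ∀ i ∈ t, f i j = a).card := by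
  classical
  have hsplit := Finset.card_filter_add_card_filter_not (s := C) fun j => ∀ i ∈ t, f i j = a
  have hunion : (C.filter fun j => ¬ ∀ i ∈ t, f i j = a).card ≤
      ∑ i ∈ t, (C.filter fun j => f i j ≠ a).card := by
    refine (Finset.card_le_card fun j hj => ?_).trans Finset.card_biUnion_le
    simp only [Finset.mem_filter, not_forall, exists_prop] at hj
    obtain ⟨hjC, i, hi, hij⟩ := hj
    exact Finset.mem_biUnion.2 ⟨i, hi, Finset.mem_filter.2 ⟨hjC, hij⟩⟩
  have hsum : r * (2 * ∑ i ∈ t, (C.filter fun j => f i j ≠ a).card) ≤ r * C.card := calc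
    _ = ∑ i ∈ t, 2 * r * (C.filter fun j => f i j ≠ a).card := by
      rw [← Finset.mul_sum]
      ring
    _ ≤ t.card • C.card := Finset.sum_le_card_nsmul _ _ _ h
    _ ≤ r * C.card := Nat.mul_le_mul_right _ ht
  have := Nat.le_of_mul_le_mul_left hsum hr
  lia

theorem exists_monochromatic_of_almost [Finite I] [Fintype J] {r : ℕ} (hr : 2 ≤ r)
    {A : Matrix I J ℕ} (hrank : (A.map (Nat.cast : ℕ → ℝ)).rank ≤ r) {R : Finset I} {C : Finset J}
    {v : ℕ} (h : 4 * r * ∑ i ∈ R, (C.filter fun j => A i j ≠ v).card < R.card * C.card) :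
    ∃ R' ⊆ R, ∃ C' ⊆ C, (∀ i ∈ R', ∀ j ∈ C', A i j = v) ∧
      R.card * C.card ≤ 4 * (R'.card * C'.card) := by
  have hC : 0 < C.card := pos_of_mul_pos_right (h.trans_le' (Nat.zero_le _)) (Nat.zero_le _)
  have hR' := card_le_two_mul_card_filter (c := 2 * r) (s := R)
    (b := fun i => (C.filter fun j => A i j ≠ v).card) hC (by linarith)
  set R' := R.filter fun i => 2 * r * (C.filter fun j => A i j ≠ v).card ≤ C.card
  have hbad : ∀ i ∈ R', 2 * r * (C.filter fun j => A i j ≠ v).card ≤ C.card := fun i hi =>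
    (Finset.mem_filter.1 hi).2
  obtain ⟨t, htR, htcard, htspan⟩ := exists_spanning_rows (A.map (Nat.cast : ℕ → ℝ)) R'
  have hC' := card_le_two_mul_card_filter_forall_eq (f := A) (a := v) (by lia)
    (htcard.trans hrank) fun i hi => hbad i (htR hi)
  set C' := C.filter fun j => ∀ i ∈ t, A i j = v
  refine ⟨R', Finset.filter_subset _ _, C', Finset.filter_subset _ _, fun i hi j hj => ?_, ?_⟩
  · obtain ⟨j₀, hj₀, hij₀⟩ : ∃ j₀ ∈ C', A i j₀ = v := by
      by_contra! hne
      have hsub : C'.card ≤ (C.filter fun j => A i j ≠ v).card := Finset.card_le_card fun j hj =>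
        Finset.mem_filter.2 ⟨(Finset.mem_filter.1 hj).1, hne j hj⟩
      nlinarith [hbad i hi]
    have hcols : ∀ k ∈ t, (A.map (Nat.cast : ℕ → ℝ)) k j = A.map Nat.cast k j₀ := fun k hk => by
      rw [Matrix.map_apply, Matrix.map_apply, (Finset.mem_filter.1 hj).2 k hk,
        (Finset.mem_filter.1 hj₀).2 k hk]
    have hrow := eq_of_mem_span_rows hcols (htspan i hi)
    simp only [Matrix.row_apply, Matrix.map_apply, Nat.cast_inj] at hrow
    rw [hrow, hij₀]
  · linarith [Nat.mul_le_mul hR' hC']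

/-- The number of multiplications of the rounding kernel with itself. -/
noncomputable def roundingCount (Δ r : ℕ) : ℕ := ⌈14 * Δ * √r * Real.log (8 * r * Δ)⌉₊

/-- The inverse of the density of the monochromatic rectangles. -/
noncomputable def rectangleDensityInv (Δ r : ℕ) : ℕ :=
  8 * (Δ + 1) * 4 ^ ((2 * Δ + 1) * roundingCount Δ r)

theorem one_lt_eight_mul_mul {Δ r : ℕ} (hΔ : 0 < Δ) (hr : 0 < r) : (1 : ℝ) < 8 * r * Δ := by
  exact_mod_cast (by nlinarith : 1 < 8 * r * Δ)

theorem roundingCount_ne_zero {Δ r : ℕ} (hΔ : 0 < Δ) (hr : 0 < r) : roundingCount Δ r ≠ 0 := by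
  have hlog := Real.log_pos (one_lt_eight_mul_mul hΔ hr)
  exact (Nat.ceil_pos.2 (by positivity)).ne'

theorem exp_half_le_one_add {x : ℝ} (h0 : 0 ≤ x) (h1 : x ≤ 1) : Real.exp (x / 2) ≤ 1 + x := by
  have hprod : Real.exp (x / 2) * (1 - x / 2) ≤ 1 := calc
    _ ≤ Real.exp (x / 2) * Real.exp (-(x / 2)) :=
      mul_le_mul_of_nonneg_left (Real.one_sub_le_exp_neg _) (Real.exp_pos _).le
    _ = 1 := by rw [← Real.exp_add, add_neg_cancel, Real.exp_zero]
  nlinarith [Real.exp_pos (x / 2)]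

theorem le_pow_roundingCount {Δ r : ℕ} (hΔ : 0 < Δ) (hr : 0 < r) :
    (8 * r * Δ : ℝ) ≤ (1 + 1 / (Δ * √r) / 7) ^ roundingCount Δ r := by
  have hone : 1 ≤ (Δ : ℝ) * √r :=
    one_le_mul_of_one_le_of_one_le (by exact_mod_cast hΔ)
      (Real.one_le_sqrt.2 (by exact_mod_cast hr))
  have hx : 1 / ((Δ : ℝ) * √r) / 7 ≤ 1 := by linarith [div_le_one_of_le₀ hone (by positivity)]
  refine le_trans ?_ (pow_le_pow_left₀ (Real.exp_pos _).le
    (exp_half_le_one_add (by positivity) hx) _)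
  rw [← Real.exp_nat_mul, ← Real.log_le_iff_le_exp (by positivity)]
  calc Real.log (8 * r * Δ)
      = 14 * Δ * √r * Real.log (8 * r * Δ) * (1 / ((Δ : ℝ) * √r) / 7 / 2) := by
        field_simp
        ring
    _ ≤ roundingCount Δ r * (1 / ((Δ : ℝ) * √r) / 7 / 2) :=
        mul_le_mul_of_nonneg_right (Nat.le_ceil _) (by positivity)

theorem exists_monochromatic_rectangle [Fintype I] [Fintype J] [Nonempty I] [Nonempty J]
    {Δ r : ℕ} (hΔ : 0 < Δ) (hr : 2 ≤ r) {A : Matrix I J ℕ} (hA : IsBoundedOfRankLE Δ r A) :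
    ∃ (R : Finset I) (C : Finset J) (v : ℕ), (∀ i ∈ R, ∀ j ∈ C, A i j = v) ∧
      Fintype.card I * Fintype.card J ≤ rectangleDensityInv Δ r * (R.card * C.card) := by
  have hr' : 0 < r := by lia
  obtain ⟨R, C, v, hbad, hcard⟩ := exists_almost_monochromatic (K := 4 * r) hΔ hr'
    (roundingCount_ne_zero hΔ hr') hA (by push_cast; linarith [le_pow_roundingCount hΔ hr'])
  obtain ⟨R', -, C', -, hmono, hcard'⟩ := exists_monochromatic_of_almost hr hA.rank_le hbad
  refine ⟨R', C', v, hmono, hcard.trans ?_⟩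
  calc _ ≤ 2 * (Δ + 1) * 4 ^ ((2 * Δ + 1) * roundingCount Δ r) * (4 * (R'.card * C'.card)) :=
      Nat.mul_le_mul_left _ hcard'
    _ = _ := by rw [rectangleDensityInv]; ring

end Rectangles

/-! ### From monochromatic rectangles to nonnegative rank -/

section NonnegRank

open scoped Matrix

variable {I J I₁ I₂ J₁ J₂ : Type*} {N N₁ N₂ : ℕ}

theorem nonnegRankLE_mul {κ : Type*} [Fintype κ] {U : Matrix I κ ℝ} {W : Matrix κ J ℝ}
    (hU : ∀ i k, 0 ≤ U i k) (hW : ∀ k j, 0 ≤ W k j) : NonnegRankLE (U * W) (Fintype.card κ) :=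
  ⟨U.submatrix id (Fintype.equivFin κ).symm, W.submatrix (Fintype.equivFin κ).symm id,
    fun _ _ => hU _ _, fun _ _ => hW _ _, (Matrix.submatrix_mul_equiv _ _ _ _ _).symm⟩

theorem NonnegRankLE.submatrix {M : Matrix I J ℝ} (h : NonnegRankLE M N) {I' J' : Type*}
    (f : I' → I) (g : J' → J) : NonnegRankLE (M.submatrix f g) N := by
  obtain ⟨U, W, hU, hW, rfl⟩ := h
  exact ⟨U.submatrix f id, W.submatrix id g, fun _ _ => hU _ _, fun _ _ => hW _ _,
    (Matrix.submatrix_mul_equiv U W f (Equiv.refl _) g).symm⟩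

theorem NonnegRankLE.transpose {M : Matrix I J ℝ} (h : NonnegRankLE M N) :
    NonnegRankLE Mᵀ N := by
  obtain ⟨U, W, hU, hW, rfl⟩ := h
  exact ⟨Wᵀ, Uᵀ, fun _ _ => hW _ _, fun _ _ => hU _ _, Matrix.transpose_mul U W⟩

theorem NonnegRankLE.fromRows {M₁ : Matrix I₁ J ℝ} {M₂ : Matrix I₂ J ℝ}
    (h₁ : NonnegRankLE M₁ N₁) (h₂ : NonnegRankLE M₂ N₂) :
    NonnegRankLE (Matrix.fromRows M₁ M₂) (N₁ + N₂) := by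
  obtain ⟨U₁, W₁, hU₁, hW₁, rfl⟩ := h₁
  obtain ⟨U₂, W₂, hU₂, hW₂, rfl⟩ := h₂
  have h := nonnegRankLE_mul (U := Matrix.fromBlocks U₁ 0 0 U₂) (W := Matrix.fromRows W₁ W₂)
    (by simp [Sum.forall, hU₁, hU₂]) (by simp [Sum.forall, hW₁, hW₂])
  simpa [Matrix.fromBlocks_mul_fromRows] using h

theorem NonnegRankLE.fromCols {M₁ : Matrix I J₁ ℝ} {M₂ : Matrix I J₂ ℝ}
    (h₁ : NonnegRankLE M₁ N₁) (h₂ : NonnegRankLE M₂ N₂) :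
    NonnegRankLE (Matrix.fromCols M₁ M₂) (N₁ + N₂) := by
  simpa [Matrix.transpose_fromRows] using (h₁.transpose.fromRows h₂.transpose).transpose

theorem nonnegRankLE_of_isEmpty {M : Matrix I J ℝ} (h : IsEmpty I ∨ IsEmpty J) :
    NonnegRankLE M N :=
  ⟨0, 0, fun _ _ => le_rfl, fun _ _ => le_rfl, by
    rcases h with h | h <;> exact Subsingleton.elim _ _⟩

theorem NonnegRankLE.mono {M : Matrix I J ℝ} (h : NonnegRankLE M N₁) (hN : N₁ ≤ N₂) :
    NonnegRankLE M N₂ := by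
  obtain ⟨k, rfl⟩ := Nat.exists_eq_add_of_le hN
  exact (h.fromRows (nonnegRankLE_of_isEmpty (M := (0 : Matrix Empty J ℝ))
    (.inl inferInstance))).submatrix Sum.inl id

theorem nonnegRankLE_of_forall_eq {M : Matrix I J ℝ} {c : ℝ} (hc : 0 ≤ c)
    (h : ∀ i j, M i j = c) : NonnegRankLE M 1 :=
  ⟨Matrix.of fun _ _ => c, Matrix.of fun _ _ => 1, fun _ _ => hc, fun _ _ => zero_le_one, by
    ext i j; simp [Matrix.mul_apply, h]⟩

theorem nonnegRankLE_one_of_rank_le_one [Finite I] [Fintype J] {M : Matrix I J ℝ}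
    (hM : ∀ i j, 0 ≤ M i j) (hrank : M.rank ≤ 1) : NonnegRankLE M 1 := by
  obtain ⟨u, v, huv⟩ := exists_rank_factorization M
  have : Subsingleton (Fin M.rank) := Fin.subsingleton_iff_le_one.2 hrank
  refine NonnegRankLE.mono ⟨u.map abs, v.map abs, fun _ _ => abs_nonneg _, fun _ _ => abs_nonneg _,
    ?_⟩ hrank
  ext i j
  have hij : M i j = ∑ k, u i k * v k j := congrFun₂ huv i j
  rw [← abs_of_nonneg (hM i j), hij]
  rcases isEmpty_or_nonempty (Fin M.rank) with _ | ⟨⟨k⟩⟩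
  · simp [Matrix.mul_apply]
  · simp [Matrix.mul_apply, Fintype.sum_subsingleton _ k, abs_mul]

theorem nonnegRankLE_of_toBlocks₁₁_eq {M : Matrix (I₁ ⊕ I₂) (J₁ ⊕ J₂) ℝ} {c : ℝ} (hc : 0 ≤ c)
    (h₁₁ : ∀ i j, M.toBlocks₁₁ i j = c) (h₁₂ : NonnegRankLE M.toBlocks₁₂ N₁)
    (h₂ : NonnegRankLE M.toRows₂ N₂) : NonnegRankLE M (1 + N₁ + N₂) := by
  rw [← M.fromRows_toRows, ← M.toRows₁.fromCols_toCols]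
  exact ((nonnegRankLE_of_forall_eq hc h₁₁).fromCols h₁₂).fromRows h₂

end NonnegRank

section Rank

variable {F I₁ I₂ J₁ J₂ : Type*} [Field F] [Finite I₁] [Finite I₂] [Fintype J₁] [Fintype J₂]

theorem rank_toBlocks_add_rank_toBlocks_le {M : Matrix (I₁ ⊕ I₂) (J₁ ⊕ J₂) F}
    (h : M.toBlocks₁₁ = 0) : M.toBlocks₁₂.rank + M.toBlocks₂₁.rank ≤ M.rank := by
  let W := Submodule.span F (Set.range M.row)
  have hrow (i : I₁ ⊕ I₂) : M.row i ∈ W := Submodule.subset_span ⟨i, rfl⟩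
  let φ : W →ₗ[F] J₁ → F := (LinearMap.funLeft F F Sum.inl).domRestrict W
  let ψ : LinearMap.ker φ →ₗ[F] J₂ → F :=
    LinearMap.funLeft F F Sum.inr ∘ₗ W.subtype ∘ₗ (LinearMap.ker φ).subtype
  have hrange : M.toBlocks₂₁.rank ≤ Module.finrank F (LinearMap.range φ) := by
    rw [Matrix.rank_eq_finrank_span_row]
    refine Submodule.finrank_mono (Submodule.span_le.2 ?_)
    rintro _ ⟨i, rfl⟩
    exact ⟨⟨M.row (Sum.inr i), hrow _⟩, rfl⟩
  have hker : M.toBlocks₁₂.rank ≤ Module.finrank F (LinearMap.ker φ) := by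
    rw [Matrix.rank_eq_finrank_span_row]
    refine (Submodule.finrank_mono (t := LinearMap.range ψ) (Submodule.span_le.2 ?_)).trans
      (LinearMap.finrank_range_le ψ)
    rintro _ ⟨i, rfl⟩
    exact ⟨⟨⟨M.row (Sum.inl i), hrow _⟩, LinearMap.mem_ker.2 (congrFun h i)⟩, rfl⟩
  calc M.toBlocks₁₂.rank + M.toBlocks₂₁.rank
      ≤ Module.finrank F (LinearMap.range φ) + Module.finrank F (LinearMap.ker φ) := by lia
    _ = M.rank := by rw [φ.finrank_range_add_finrank_ker, M.rank_eq_finrank_span_row]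

theorem rank_add_le {I J : Type*} [Finite I] [Fintype J] (M M' : Matrix I J F) :
    (M + M').rank ≤ M.rank + M'.rank := by
  rw [Matrix.rank, Matrix.mulVecLin_add]
  exact (Submodule.finrank_mono (LinearMap.range_add_le _ _)).trans
    (Submodule.finrank_add_le_finrank_add_finrank _ _)

theorem rank_toBlocks_add_rank_toBlocks_le_add_one {M : Matrix (I₁ ⊕ I₂) (J₁ ⊕ J₂) F} {c : F}
    (h : ∀ i j, M.toBlocks₁₁ i j = c) :
    M.toBlocks₁₂.rank + M.toBlocks₂₁.rank ≤ M.rank + 1 := by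
  let Z : Matrix (I₁ ⊕ I₂) (J₁ ⊕ J₂) F :=
    Matrix.vecMulVec (Sum.elim (fun _ => -c) 0) (Sum.elim (fun _ => 1) 0)
  have hzero : (M + Z).toBlocks₁₁ = 0 := by
    ext i j
    simpa [Z, Matrix.vecMulVec_apply, Matrix.toBlocks₁₁, add_neg_eq_zero] using h i j
  have h₁₂ : (M + Z).toBlocks₁₂ = M.toBlocks₁₂ := by
    ext; simp [Z, Matrix.vecMulVec_apply, Matrix.toBlocks₁₂]
  have h₂₁ : (M + Z).toBlocks₂₁ = M.toBlocks₂₁ := by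
    ext; simp [Z, Matrix.vecMulVec_apply, Matrix.toBlocks₂₁]
  calc M.toBlocks₁₂.rank + M.toBlocks₂₁.rank ≤ (M + Z).rank := by
        simpa only [h₁₂, h₂₁] using rank_toBlocks_add_rank_toBlocks_le hzero
    _ ≤ M.rank + 1 := (rank_add_le M Z).trans (by gcongr; exact Matrix.rank_vecMulVec_le _ _)

end Rank

namespace IsBoundedOfRankLE

open scoped Matrix

variable {I J : Type*} [Fintype J] {Δ r : ℕ} {A : Matrix I J ℕ}

theorem submatrix (hA : IsBoundedOfRankLE Δ r A) {I' J' : Type*} [Fintype J'] (f : I' → I)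
    (g : J' → J) : IsBoundedOfRankLE Δ r (A.submatrix f g) where
  le _ _ := hA.le _ _
  rank_le := (Matrix.rank_submatrix_le (A.map Nat.cast) f g).trans hA.rank_le

theorem transpose [Fintype I] (hA : IsBoundedOfRankLE Δ r A) : IsBoundedOfRankLE Δ r Aᵀ where
  le _ _ := hA.le _ _
  rank_le := by rw [Matrix.transpose_map, Matrix.rank_transpose]; exact hA.rank_le

theorem card_range_row_le [Finite I] (hA : IsBoundedOfRankLE Δ r A) :
    Nat.card (Set.range A.row) ≤ (Δ + 1) ^ r := by
  have := Fintype.ofFinite I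
  obtain ⟨t, -, htcard, ht⟩ := exists_spanning_rows (A.map (Nat.cast : ℕ → ℝ))ᵀ Finset.univ
  rw [Matrix.rank_transpose] at htcard
  let restrict (f : Set.range A.row) (j : t) : Fin (Δ + 1) :=
    ⟨f.1 j, by obtain ⟨_, i, rfl⟩ := f; exact Nat.lt_succ_of_le (hA.le i j)⟩
  have hinj : Function.Injective restrict := by
    rintro ⟨_, i, rfl⟩ ⟨_, i', rfl⟩ h
    ext j
    have hcols : ∀ k ∈ t, (A i k : ℝ) = A i' k := fun k hk =>
      congrArg Nat.cast (congrArg Fin.val (congrFun h ⟨k, hk⟩))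
    have hij := eq_of_mem_span_rows hcols (ht j (Finset.mem_univ j))
    exact Nat.cast_injective (R := ℝ) hij
  calc Nat.card (Set.range A.row) ≤ Nat.card (t → Fin (Δ + 1)) :=
        Nat.card_le_card_of_injective restrict hinj
    _ = (Δ + 1) ^ t.card := by simp [Nat.card_fun]
    _ ≤ (Δ + 1) ^ r := Nat.pow_le_pow_right (by lia) (htcard.trans hA.rank_le)

end IsBoundedOfRankLE

/-- Every matrix of rank at most `r` with entries in `{0, …, Δ}` has nonnegative rank at most
`N`. Only the index types `Fin m` are quantified over, to keep the statement in a single universe;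
see `NonnegRankBound.nonnegRankLE` for arbitrary finite index types. -/
def NonnegRankBound (Δ r N : ℕ) : Prop :=
  ∀ (m n : ℕ) (A : Matrix (Fin m) (Fin n) ℕ), IsBoundedOfRankLE Δ r A →
    NonnegRankLE (A.map Nat.cast) N

section NonnegRankBound

open scoped Matrix

variable {I J : Type*} [Fintype J] {Δ r N : ℕ}

theorem NonnegRankBound.nonnegRankLE [Finite I] (hN : NonnegRankBound Δ r N) {A : Matrix I J ℕ}
    (hA : IsBoundedOfRankLE Δ r A) : NonnegRankLE (A.map Nat.cast) N := by
  have e := Finite.equivFin I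
  have f := Fintype.equivFin J
  simpa [Matrix.submatrix_map] using (hN _ _ _ (hA.submatrix e.symm f.symm)).submatrix e f

theorem nonnegRankBound_of_rank_le_one (hr : r ≤ 1) : NonnegRankBound Δ r 1 := fun _ _ _ hA =>
  nonnegRankLE_one_of_rank_le_one (fun _ _ => Nat.cast_nonneg _) (hA.rank_le.trans hr)

theorem nonnegRankBound_zero (r : ℕ) : NonnegRankBound 0 r 1 := fun _ _ _ hA =>
  nonnegRankLE_of_forall_eq le_rfl fun i j => by simp [Nat.le_zero.1 (hA.le i j)]

theorem NonnegRankBound.nonnegRankLE_of_toBlocks₁₁_eq {I₁ I₂ J₁ J₂ : Type*} [Finite I₁]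
    [Finite I₂] [Fintype J₁] [Fintype J₂] {A : Matrix (I₁ ⊕ I₂) (J₁ ⊕ J₂) ℕ} {v N' : ℕ}
    (hN : NonnegRankBound Δ ((r + 1) / 2) N) (hA : IsBoundedOfRankLE Δ r A)
    (h₁₁ : ∀ i j, A.toBlocks₁₁ i j = v) (hrows : NonnegRankLE (A.toRows₂.map Nat.cast) N')
    (hcols : NonnegRankLE (A.toCols₂.map Nat.cast) N') :
    NonnegRankLE (A.map Nat.cast) (1 + N + N') := by
  have hv : ∀ i j, (A.map (Nat.cast : ℕ → ℝ)).toBlocks₁₁ i j = v := fun i j =>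
    congrArg Nat.cast (h₁₁ i j)
  have hrank := rank_toBlocks_add_rank_toBlocks_le_add_one hv
  rcases le_or_gt (A.map (Nat.cast : ℕ → ℝ)).toBlocks₁₂.rank ((r + 1) / 2) with h₁₂ | h₁₂
  · exact _root_.nonnegRankLE_of_toBlocks₁₁_eq v.cast_nonneg hv
      (hN.nonnegRankLE (A := A.toBlocks₁₂) ⟨fun _ _ => hA.le _ _, h₁₂⟩) hrows
  · have h₂₁ : (A.map (Nat.cast : ℕ → ℝ)).toBlocks₂₁.rank ≤ (r + 1) / 2 := by
      have := hA.rank_le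
      lia
    exact (_root_.nonnegRankLE_of_toBlocks₁₁_eq (M := (A.map Nat.cast)ᵀ) v.cast_nonneg
      (fun j i => hv i j) (hN.nonnegRankLE (A := A.toBlocks₂₁)
        ⟨fun _ _ => hA.le _ _, h₂₁⟩).transpose hcols.transpose).transpose

theorem mul_pred_pow_lt_of_le {D k m m' s : ℕ} (hD : 0 < D) (hm : m ≤ D * k) (hm' : m' + k ≤ m)
    (h : m * (D - 1) ^ (s + 1) < D ^ (s + 1)) : m' * (D - 1) ^ s < D ^ s := by
  have hshrink : D * m' ≤ m * (D - 1) := by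
    obtain ⟨E, rfl⟩ := Nat.exists_eq_add_of_le' hD
    rw [Nat.add_sub_cancel]
    nlinarith
  refine lt_of_mul_lt_mul_left (a := D) ?_ (Nat.zero_le _)
  calc D * (m' * (D - 1) ^ s) = D * m' * (D - 1) ^ s := (mul_assoc _ _ _).symm
    _ ≤ m * (D - 1) * (D - 1) ^ s := Nat.mul_le_mul_right _ hshrink
    _ = m * (D - 1) ^ (s + 1) := by ring
    _ < D ^ (s + 1) := h
    _ = D * D ^ s := pow_succ' D s

theorem rectangleDensityInv_pos (Δ r : ℕ) : 0 < rectangleDensityInv Δ r := by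
  unfold rectangleDensityInv
  positivity

theorem card_notMem_mul_card_add_le [Fintype I] [DecidableEq I] (R : Finset I) (C : Finset J) :
    Fintype.card {i // i ∉ R} * Fintype.card J + R.card * C.card ≤
      Fintype.card I * Fintype.card J := by
  calc Fintype.card {i // i ∉ R} * Fintype.card J + R.card * C.card
      ≤ Fintype.card {i // i ∉ R} * Fintype.card J + R.card * Fintype.card J := by
        gcongr
        exact C.card_le_univ
    _ = Fintype.card I * Fintype.card J := by
        rw [← add_mul, Fintype.card_subtype_compl, Fintype.card_coe,
          Nat.sub_add_cancel R.card_le_univ]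

theorem NonnegRankBound.nonnegRankLE_of_card_mul_pow_lt (hΔ : 0 < Δ) (hr : 2 ≤ r)
    (hN : NonnegRankBound Δ ((r + 1) / 2) N) [Fintype I] {A : Matrix I J ℕ}
    (hA : IsBoundedOfRankLE Δ r A) {s : ℕ}
    (hs : Fintype.card I * Fintype.card J * (rectangleDensityInv Δ r - 1) ^ s <
      rectangleDensityInv Δ r ^ s) :
    NonnegRankLE (A.map Nat.cast) (s * (1 + N)) := by
  classical
  induction s generalizing I J with
  | zero =>
    exact nonnegRankLE_of_isEmpty (by simpa [Fintype.card_eq_zero_iff] using hs)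
  | succ s ih =>
    by_cases hempty : IsEmpty I ∨ IsEmpty J
    · exact nonnegRankLE_of_isEmpty hempty
    obtain ⟨_, _⟩ : Nonempty I ∧ Nonempty J := by simpa using hempty
    obtain ⟨R, C, v, hmono, hRC⟩ := exists_monochromatic_rectangle hΔ hr hA
    let e := Equiv.sumCompl (· ∈ R)
    let f := Equiv.sumCompl (· ∈ C)
    have hrows : NonnegRankLE ((A.submatrix e f).toRows₂.map Nat.cast) (s * (1 + N)) := by
      refine ih (hA.submatrix _ _) (mul_pred_pow_lt_of_le (rectangleDensityInv_pos Δ r) hRC ?_ hs)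
      rw [Fintype.card_congr f]
      exact card_notMem_mul_card_add_le R C
    have hcols : NonnegRankLE ((A.submatrix e f).toCols₂.map Nat.cast) (s * (1 + N)) := by
      refine ih (hA.submatrix _ _) (mul_pred_pow_lt_of_le (rectangleDensityInv_pos Δ r) hRC ?_ hs)
      rw [Fintype.card_congr e]
      have := card_notMem_mul_card_add_le C R
      lia
    have hpeel := hN.nonnegRankLE_of_toBlocks₁₁_eq (hA.submatrix e f)
      (fun i j => hmono i i.2 j j.2) hrows hcols
    convert hpeel.submatrix e.symm f.symm using 1
    · simp [← Matrix.submatrix_map]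
    · ring

theorem NonnegRankBound.of_half_rank (hΔ : 0 < Δ) (hr : 2 ≤ r)
    (hN : NonnegRankBound Δ ((r + 1) / 2) N) {s : ℕ}
    (hs : (Δ + 1) ^ (2 * r) * (rectangleDensityInv Δ r - 1) ^ s < rectangleDensityInv Δ r ^ s) :
    NonnegRankBound Δ r (s * (1 + N)) := by
  intro m n A hA
  have := Fintype.ofFinite (Set.range A.row)
  have := Fintype.ofFinite (Set.range Aᵀ.row)
  have hcard : Fintype.card (Set.range A.row) * Fintype.card (Set.range Aᵀ.row) ≤
      (Δ + 1) ^ (2 * r) := by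
    rw [two_mul, pow_add, Fintype.card_eq_nat_card, Fintype.card_eq_nat_card]
    exact Nat.mul_le_mul hA.card_range_row_le hA.transpose.card_range_row_le
  have hdistinct := hN.nonnegRankLE_of_card_mul_pow_lt hΔ hr
    (hA.submatrix (Set.rangeSplitting A.row) (Set.rangeSplitting Aᵀ.row))
    ((Nat.mul_le_mul_right _ hcard).trans_lt hs)
  convert hdistinct.submatrix (Set.rangeFactorization A.row) (Set.rangeFactorization Aᵀ.row)
    using 1
  ext i j
  set i' := Set.rangeSplitting A.row (Set.rangeFactorization A.row i)
  set j' := Set.rangeSplitting Aᵀ.row (Set.rangeFactorization Aᵀ.row j)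
  have hrow : A.row i' = A.row i := Set.apply_rangeSplitting _ _
  have hcol : Aᵀ.row j' = Aᵀ.row j := Set.apply_rangeSplitting _ _
  calc (A i j : ℝ) = A i' j := congrArg Nat.cast (congrFun hrow j).symm
    _ = A i' j' := congrArg Nat.cast (congrFun hcol i').symm

end NonnegRankBound

/-! ### Quantitative bounds -/

theorem pow_mul_pred_pow_lt_pow {a r D : ℕ} (hr : 0 < r) (hD : 0 < D) :
    a ^ (2 * r) * (D - 1) ^ (2 * r * a * D) < D ^ (2 * r * a * D) := by
  have hpred : ((D - 1 : ℕ) : ℝ) ≤ D * Real.exp (-(1 / D)) := by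
    calc ((D - 1 : ℕ) : ℝ) = D * (1 - 1 / D) := by
          rw [Nat.cast_sub hD, Nat.cast_one]
          field_simp
      _ ≤ _ := mul_le_mul_of_nonneg_left (Real.one_sub_le_exp_neg _) D.cast_nonneg
  have hlt : (a : ℝ) < Real.exp a := by linarith [Real.add_one_le_exp (a : ℝ)]
  have hreal : (a : ℝ) ^ (2 * r) * ((D - 1 : ℕ) : ℝ) ^ (2 * r * a * D) <
      (D : ℝ) ^ (2 * r * a * D) := calc
    _ ≤ (a : ℝ) ^ (2 * r) * (D * Real.exp (-(1 / D))) ^ (2 * r * a * D) := by gcongr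
    _ < Real.exp a ^ (2 * r) * (D * Real.exp (-(1 / D))) ^ (2 * r * a * D) := by
      gcongr
    _ = (D : ℝ) ^ (2 * r * a * D) *
        Real.exp ((2 * r : ℕ) * a + (2 * r * a * D : ℕ) * -(1 / (D : ℝ))) := by
      rw [mul_pow, ← Real.exp_nat_mul, ← Real.exp_nat_mul, mul_left_comm, ← Real.exp_add]
    _ = (D : ℝ) ^ (2 * r * a * D) := by
      rw [mul_eq_left₀ (by positivity), Real.exp_eq_one_iff]
      push_cast
      field_simp
      ring
  exact_mod_cast hreal

/-- The cost of halving the rank: the number of monochromatic rectangles to be split off until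
fewer than one entry is left. -/
noncomputable def stepCount (Δ r : ℕ) : ℕ := 2 * r * (Δ + 1) * rectangleDensityInv Δ r

section StepCount

variable {Δ r : ℕ}

theorem log_eight_mul_mul_le (hΔ : 0 < Δ) (hr : 2 ≤ r) :
    Real.log (8 * r * Δ) ≤ 6 * Δ * Real.log r := by
  have hΔ' : (1 : ℝ) ≤ Δ := by exact_mod_cast hΔ
  have hlog_two := Real.log_two_gt_d9
  have hlog_r : Real.log 2 ≤ Real.log r := Real.log_le_log two_pos (by exact_mod_cast hr)
  have hlog_Δ : Real.log Δ ≤ Δ := Real.log_le_self Δ.cast_nonneg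
  have hlog_eight : Real.log 8 = 3 * Real.log 2 := by
    rw [show (8 : ℝ) = 2 ^ 3 by norm_num, Real.log_pow, Nat.cast_ofNat]
  rw [Real.log_mul (by positivity) (by positivity), Real.log_mul (by positivity) (by positivity)]
  nlinarith

theorem half_le_sqrt_mul_log (hr : 2 ≤ r) : 1 / 2 ≤ √r * Real.log r := by
  have hlog : Real.log 2 ≤ Real.log r := Real.log_le_log two_pos (by exact_mod_cast hr)
  have hsqrt : 1 ≤ √(r : ℝ) := Real.one_le_sqrt.2 (by exact_mod_cast (by lia : 1 ≤ r))
  nlinarith [Real.log_two_gt_d9]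

theorem roundingCount_le (hΔ : 0 < Δ) (hr : 2 ≤ r) :
    roundingCount Δ r ≤ 86 * (Δ : ℝ) ^ 2 * (√r * Real.log r) := by
  have hlog := Real.log_pos (one_lt_eight_mul_mul hΔ (by lia : 0 < r))
  have hΔ' : (1 : ℝ) ≤ (Δ : ℝ) ^ 2 := one_le_pow₀ (by exact_mod_cast hΔ)
  calc (roundingCount Δ r : ℝ) ≤ 14 * Δ * √r * Real.log (8 * r * Δ) + 1 :=
        (Nat.ceil_lt_add_one (by positivity)).le
    _ ≤ 14 * Δ * √r * (6 * Δ * Real.log r) + 2 * (Δ : ℝ) ^ 2 * (√r * Real.log r) := by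
        gcongr
        · exact log_eight_mul_mul_le hΔ hr
        · nlinarith [half_le_sqrt_mul_log hr]
    _ = 86 * (Δ : ℝ) ^ 2 * (√r * Real.log r) := by ring

theorem log_two_mul_stepCount (hr : 0 < r) :
    Real.log (2 * stepCount Δ r) = 5 * Real.log 2 + Real.log r + 2 * Real.log (Δ + 1) +
      (2 * Δ + 1) * roundingCount Δ r * (2 * Real.log 2) := by
  have hpow : (2 * stepCount Δ r : ℝ) =
      2 ^ 5 * r * (Δ + 1) ^ 2 * (2 ^ 2) ^ ((2 * Δ + 1) * roundingCount Δ r) := by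
    simp only [stepCount, rectangleDensityInv]
    push_cast
    ring
  rw [hpow, Real.log_mul (by positivity) (by positivity),
    Real.log_mul (by positivity) (by positivity), Real.log_mul (by positivity) (by positivity)]
  simp only [Real.log_pow]
  push_cast
  ring

theorem log_two_mul_stepCount_le (hΔ : 0 < Δ) (hr : 2 ≤ r) :
    Real.log (2 * stepCount Δ r) ≤ 600 * (Δ : ℝ) ^ 3 * (√r * Real.log r) := by
  rw [log_two_mul_stepCount (by lia)]
  set X := √r * Real.log r
  have hΔ' : (1 : ℝ) ≤ Δ := by exact_mod_cast hΔ
  have hΔ_pow : (Δ : ℝ) ≤ (Δ : ℝ) ^ 3 := le_self_pow₀ hΔ' (by norm_num)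
  have hX : 1 / 2 ≤ X := half_le_sqrt_mul_log hr
  have hlog_r : Real.log r ≤ X := le_mul_of_one_le_left (Real.log_natCast_nonneg r)
    (Real.one_le_sqrt.2 (by exact_mod_cast (by lia : 1 ≤ r)))
  have hlog_Δ : Real.log (Δ + 1) ≤ Δ := by
    simpa using Real.log_le_sub_one_of_pos (by positivity : (0 : ℝ) < Δ + 1)
  have hcount : (2 * Δ + 1) * roundingCount Δ r ≤ 258 * ((Δ : ℝ) ^ 3 * X) := calc
    _ ≤ (3 * Δ) * (86 * (Δ : ℝ) ^ 2 * X) := by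
      gcongr
      · linarith
      · exact roundingCount_le hΔ hr
    _ = _ := by ring
  have hX_le : X ≤ (Δ : ℝ) ^ 3 * X := le_mul_of_one_le_left (by linarith) (hΔ'.trans hΔ_pow)
  have hΔ_le : (Δ : ℝ) ≤ 2 * ((Δ : ℝ) ^ 3 * X) := by nlinarith
  nlinarith [Real.log_two_gt_d9, Real.log_two_lt_d9]

end StepCount

theorem sqrt_mul_log_half_le {r : ℕ} (hr : 2 ≤ r) :
    √((r + 1) / 2 : ℕ) * Real.log ((r + 1) / 2 : ℕ) ≤ 7 / 8 * (√r * Real.log r) := by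
  have hhalf : (((r + 1) / 2 : ℕ) : ℝ) ≤ (7 / 8) ^ 2 * r := by
    have : (4 * ((r + 1) / 2 : ℕ) : ℝ) ≤ 3 * r := by exact_mod_cast (by lia)
    linarith
  have hsqrt : √((r + 1) / 2 : ℕ) ≤ 7 / 8 * √r := calc
    _ ≤ √((7 / 8) ^ 2 * r) := Real.sqrt_le_sqrt hhalf
    _ = 7 / 8 * √r := by rw [Real.sqrt_mul (by positivity), Real.sqrt_sq (by norm_num)]
  have hlog : Real.log ((r + 1) / 2 : ℕ) ≤ Real.log r :=
    Real.log_le_log (by exact_mod_cast (by lia)) (by exact_mod_cast (by lia))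
  calc _ ≤ 7 / 8 * √r * Real.log r :=
        mul_le_mul hsqrt hlog (Real.log_natCast_nonneg _) (by positivity)
    _ = _ := mul_assoc _ _ _

/-- The logarithm of the bound on the nonnegative rank of matrices of rank at most `r` with entries
in `{0, …, Δ}`. -/
noncomputable def logNonnegRankBound (Δ r : ℕ) : ℝ := 5000 * (Δ : ℝ) ^ 3 * (√r * Real.log r)

theorem logNonnegRankBound_nonneg (Δ r : ℕ) : 0 ≤ logNonnegRankBound Δ r := by
  have := Real.log_natCast_nonneg r
  unfold logNonnegRankBound
  positivity

theorem stepCount_mul_one_add_floor_le {Δ r : ℕ} (hΔ : 0 < Δ) (hr : 2 ≤ r) :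
    stepCount Δ r * (1 + ⌊Real.exp (logNonnegRankBound Δ ((r + 1) / 2))⌋₊) ≤
      ⌊Real.exp (logNonnegRankBound Δ r)⌋₊ := by
  set B := logNonnegRankBound Δ ((r + 1) / 2)
  have hB : 1 ≤ Real.exp B := Real.one_le_exp (logNonnegRankBound_nonneg _ _)
  have hfloor : (⌊Real.exp B⌋₊ : ℝ) ≤ Real.exp B := Nat.floor_le (Real.exp_pos _).le
  have hstep_pos : (0 : ℝ) < 2 * stepCount Δ r := by
    have := rectangleDensityInv_pos Δ r
    unfold stepCount
    positivity
  have hstep : (2 * stepCount Δ r : ℝ) ≤ Real.exp (600 * (Δ : ℝ) ^ 3 * (√r * Real.log r)) :=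
    (Real.log_le_iff_le_exp hstep_pos).1 (log_two_mul_stepCount_le hΔ hr)
  refine Nat.le_floor ?_
  push_cast
  calc (stepCount Δ r : ℝ) * (1 + ⌊Real.exp B⌋₊) ≤ 2 * stepCount Δ r * Real.exp B := by nlinarith
    _ ≤ Real.exp (600 * (Δ : ℝ) ^ 3 * (√r * Real.log r)) * Real.exp B := by gcongr
    _ = Real.exp (600 * (Δ : ℝ) ^ 3 * (√r * Real.log r) + B) := (Real.exp_add _ _).symm
    _ ≤ Real.exp (logNonnegRankBound Δ r) := by
        refine Real.exp_le_exp.2 ?_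
        calc _ ≤ 600 * (Δ : ℝ) ^ 3 * (√r * Real.log r) +
              5000 * (Δ : ℝ) ^ 3 * (7 / 8 * (√r * Real.log r)) := by
              gcongr
              exact mul_le_mul_of_nonneg_left (sqrt_mul_log_half_le hr) (by positivity)
          _ = 4975 * ((Δ : ℝ) ^ 3 * (√r * Real.log r)) := by ring
          _ ≤ 5000 * ((Δ : ℝ) ^ 3 * (√r * Real.log r)) := by
              have := Real.log_natCast_nonneg r
              gcongr
              norm_num
          _ = logNonnegRankBound Δ r := (mul_assoc _ _ _).symm

theorem nonnegRankBound_floor_exp (Δ r : ℕ) :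
    NonnegRankBound Δ r ⌊Real.exp (logNonnegRankBound Δ r)⌋₊ := by
  rcases Nat.eq_zero_or_pos Δ with rfl | hΔ
  · simpa [logNonnegRankBound] using nonnegRankBound_zero r
  induction r using Nat.strong_induction_on with
  | _ r ih =>
    rcases Nat.lt_or_ge r 2 with hr | hr
    · have hlog : logNonnegRankBound Δ r = 0 := by
        interval_cases r <;> simp [logNonnegRankBound]
      simpa [hlog] using nonnegRankBound_of_rank_le_one (Nat.le_of_lt_succ hr)
    · have hstep := (ih ((r + 1) / 2) (by lia)).of_half_rank hΔ hr
        (pow_mul_pred_pow_lt_pow (by lia) (rectangleDensityInv_pos Δ r))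
      exact fun m n A hA => (hstep m n A hA).mono (stepCount_mul_one_add_floor_le hΔ hr)

theorem twenty_thousand_mul_pow_three_le (Δ : ℕ) :
    20000 * (Δ : ℝ) ^ 3 ≤ ((max Δ 2 : ℕ) : ℝ) ^ (20 * Δ) := by
  rcases Nat.eq_zero_or_pos Δ with rfl | hΔ
  · simp
  have hnat : 20000 * Δ ^ 3 ≤ max Δ 2 ^ (20 * Δ) := calc
    20000 * Δ ^ 3 ≤ max Δ 2 ^ 17 * max Δ 2 ^ 3 :=
      Nat.mul_le_mul (le_trans (by norm_num) (Nat.pow_le_pow_left (le_max_right Δ 2) 17))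
        (Nat.pow_le_pow_left (le_max_left Δ 2) 3)
    _ = max Δ 2 ^ 20 := (pow_add _ 17 3).symm
    _ ≤ max Δ 2 ^ (20 * Δ) := Nat.pow_le_pow_right (by lia) (by lia)
  exact_mod_cast hnat

theorem sqrt_succ_mul_log_succ_le {n : ℕ} (hn : 2 ≤ n) :
    √(n + 1 : ℕ) * Real.log (n + 1 : ℕ) ≤ 4 * (√n * Real.log n) := by
  have hn2 : (2 : ℝ) ≤ n := by exact_mod_cast hn
  have hsqrt : √(n + 1 : ℕ) ≤ 2 * √n := by
    rw [Real.sqrt_le_left (by positivity), mul_pow, Real.sq_sqrt (by positivity)]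
    push_cast
    linarith
  have hlog : Real.log (n + 1 : ℕ) ≤ 2 * Real.log n := calc
    Real.log (n + 1 : ℕ) ≤ Real.log (n ^ 2) :=
      Real.log_le_log (by positivity) (by push_cast; nlinarith)
    _ = 2 * Real.log n := by rw [Real.log_pow, Nat.cast_two]
  calc _ ≤ 2 * √n * (2 * Real.log n) :=
        mul_le_mul hsqrt hlog (Real.log_natCast_nonneg _) (by positivity)
    _ = _ := by ring

theorem logNonnegRankBound_succ_le (Δ : ℕ) {n : ℕ} (hn : 2 ≤ n) :
    logNonnegRankBound Δ (n + 1) ≤ ((max Δ 2 : ℕ) : ℝ) ^ (20 * Δ) * √n * Real.log n := calc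
  logNonnegRankBound Δ (n + 1) ≤ 5000 * (Δ : ℝ) ^ 3 * (4 * (√n * Real.log n)) :=
    mul_le_mul_of_nonneg_left (sqrt_succ_mul_log_succ_le hn) (by positivity)
  _ = 20000 * (Δ : ℝ) ^ 3 * (√n * Real.log n) := by ring
  _ ≤ ((max Δ 2 : ℕ) : ℝ) ^ (20 * Δ) * (√n * Real.log n) :=
    mul_le_mul_of_nonneg_right (twenty_thousand_mul_pow_three_le Δ)
      (mul_nonneg (Real.sqrt_nonneg _) (Real.log_natCast_nonneg n))
  _ = _ := (mul_assoc _ _ _).symm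

/-! ### Slack matrices -/

theorem IsPolytope.finite_setOf_isExposed {d : ℕ} {P : Set (Fin d → ℝ)} (hP : IsPolytope P) :
    {F | IsExposed ℝ P F}.Finite := by
  refine Set.Finite.of_injOn (f := Set.extremePoints ℝ) (t := 𝒫 P.extremePoints ℝ)
    (fun F hF => hF.isExtreme.extremePoints_subset_extremePoints) (fun F hF G hG hFG => ?_)
    hP.finite_extremePoints.finite_subsets
  rw [← closure_convexHull_extremePoints (hF.isCompact hP.isCompact) (hF.convex hP.convex), hFG,
    closure_convexHull_extremePoints (hG.isCompact hP.isCompact) (hG.convex hP.convex)]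

theorem rank_of_sub_dotProduct_le {d : ℕ} {I J : Type*} [Fintype J]
    (a : I → Fin d → ℝ) (b : I → ℝ) (v : J → Fin d → ℝ) :
    (Matrix.of fun i j => b i - a i ⬝ᵥ v j).rank ≤ affDim (Set.range v) + 1 := by
  obtain hJ | ⟨⟨j₀⟩⟩ := isEmpty_or_nonempty J
  · exact (Matrix.rank_le_card_width _).trans (by simp)
  let L : ℝ × vectorSpan ℝ (Set.range v) →ₗ[ℝ] I → ℝ := LinearMap.pi fun i =>
    (b i - a i ⬝ᵥ v j₀) • LinearMap.fst ℝ _ _ -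
      dotProductBilin ℝ ℝ (a i) ∘ₗ (vectorSpan ℝ (Set.range v)).subtype ∘ₗ LinearMap.snd ℝ _ _
  have hcols : Submodule.span ℝ (Set.range (Matrix.of fun i j => b i - a i ⬝ᵥ v j).col) ≤
      LinearMap.range L := by
    refine Submodule.span_le.2 ?_
    rintro _ ⟨j, rfl⟩
    refine ⟨(1, ⟨v j - v j₀, vsub_mem_vectorSpan ℝ ⟨j, rfl⟩ ⟨j₀, rfl⟩⟩), ?_⟩
    ext i
    simp [L, dotProduct_sub]
  calc _ ≤ Module.finrank ℝ (LinearMap.range L) := by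
        rw [Matrix.rank_eq_finrank_span_cols]
        exact Submodule.finrank_mono hcols
    _ ≤ Module.finrank ℝ (ℝ × vectorSpan ℝ (Set.range v)) := LinearMap.finrank_range_le L
    _ = affDim (Set.range v) + 1 := by
        rw [Module.finrank_prod, Module.finrank_self, add_comm, affDim]

theorem IsSlackMatrix.rank_le {d : ℕ} {P : Set (Fin d → ℝ)}
    [Fintype (P.extremePoints ℝ)]
    {S : Matrix {F : Set (Fin d → ℝ) // IsFacet P F} (P.extremePoints ℝ) ℝ}
    (hS : IsSlackMatrix P S) : S.rank ≤ affDim P + 1 := by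
  obtain ⟨a, b, -, hSab⟩ := hS
  have hrank := rank_of_sub_dotProduct_le a b ((↑) : P.extremePoints ℝ → Fin d → ℝ)
  rw [Subtype.range_coe] at hrank
  obtain rfl : S = Matrix.of fun f v => b f - a f ⬝ᵥ v.1 := Matrix.ext hSab
  exact hrank.trans
    (Nat.succ_le_succ (Submodule.finrank_mono (vectorSpan_mono ℝ extremePoints_subset)))

theorem mainTheorem2_general {Δ d : ℕ} {P : Set (Fin d → ℝ)} (hP : IsPolytope P)
    {S : Matrix {F : Set (Fin d → ℝ) // IsFacet P F} (P.extremePoints ℝ) ℝ}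
    (hS : IsSlackMatrix P S) (hSΔ : ∀ f v, ∃ k : ℕ, k ≤ Δ ∧ S f v = (k : ℝ)) :
    ((extensionComplexity P : ℕ∞) : ENNReal) ≤
      ENNReal.ofReal (Real.exp (logNonnegRankBound Δ (affDim P + 1))) := by
  have := hP.finite_extremePoints.fintype
  have : Finite {F : Set (Fin d → ℝ) // IsFacet P F} :=
    (hP.finite_setOf_isExposed.subset fun F hF => hF.2.1).to_subtype
  choose A hA hSA using hSΔ
  obtain rfl : S = Matrix.map A Nat.cast := Matrix.ext hSA
  have hN := (nonnegRankBound_floor_exp Δ (affDim P + 1)).nonnegRankLE ⟨hA, hS.rank_le⟩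
  calc ((extensionComplexity P : ℕ∞) : ENNReal)
      ≤ ((⌊Real.exp (logNonnegRankBound Δ (affDim P + 1))⌋₊ : ℕ∞) : ENNReal) := by
        exact_mod_cast extensionComplexity_le_of_nonnegRankLE hP hS hN
    _ = ENNReal.ofReal ⌊Real.exp (logNonnegRankBound Δ (affDim P + 1))⌋₊ := by simp
    _ ≤ _ := ENNReal.ofReal_le_ofReal (Nat.floor_le (Real.exp_pos _).le)

theorem mainTheorem2 :
    ∃ C : ℕ, ∀ (Δ n d : ℕ) (P : Set (Fin d → ℝ)),
      2 ≤ n → IsPolytope P → affDim P = n →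
      ∀ S : Matrix {F : Set (Fin d → ℝ) // IsFacet P F} (P.extremePoints ℝ) ℝ,
        IsSlackMatrix P S →
        (∀ f v, ∃ k : ℕ, k ≤ Δ ∧ S f v = (k : ℝ)) →
        ((extensionComplexity P : ℕ∞) : ENNReal) ≤
          ENNReal.ofReal
            (Real.exp (((max Δ 2 : ℕ) : ℝ) ^ (C * Δ) * Real.sqrt (n : ℝ) * Real.log (n : ℝ))) := by
  refine ⟨20, fun Δ n d P hn hP hdim S hS hSΔ => (mainTheorem2_general hP hS hSΔ).trans ?_⟩
  subst hdim
  exact ENNReal.ofReal_le_ofReal (Real.exp_le_exp.2 (logNonnegRankBound_succ_le Δ hn))
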